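/- Let $(M,g)$ be a connected, Hausdorff, second countable smooth Riemannian manifold of bounded geometry, that is, its injectivity radius is strictly positive and, for every $k=0,1,2,\dots$, the pointwise norm $\|\nabla^k R\|_g$ of the $k$-th Levi-Civita covariant derivative of the Riemann curvature tensor $R$ is bounded on $M$. Let $d_{(M,g)}$ be the Riemannian distance. Let $A$ be a smooth vector field on $M$ such that, for some $c_1,c_2\in(0,+\infty)$, \[ \sup_{x\in M}\|A(x)\|_g\le c_1\qquad\text{and}\qquad \sup_{x\in M}\|\nabla A(x)\|_g\le c_2, \] where $\nabla$ is the Levi-Civita connection and $\|\cdot\|_g$ is the pointwise norm on tensors induced by $g$. Then, for every $\gamma_0\in M$, the Cauchy problem $\dot\gamma(t)=A(\gamma(t))$, $\gamma(0)=\gamma_0$ has a unique solution $\gamma:\mathbb{R}\to M$ defined on the whole real line, and it is smooth. Moreover, there exists $T>0$, independent of $\gamma_0$, such that for every $\gamma_0\in M$ the function \[ d_{\gamma_0}(t):=d_{(M,g)}(\gamma(0),\gamma(t)) \] is non-decreasing on $[0,T]$, and it is strictly increasing on $[0,T]$ if $A(\gamma_0)\neq 0$. -/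

import Mathlib

open Set Manifold Bundle
open scoped ContDiff Topology ENNReal

noncomputable section

/-! ## Tensor calculus in a chart

Throughout, `M` is a smooth `n`-dimensional Riemannian manifold and `φ` is a smooth chart of `M`
with values in `ℝⁿ`. A tensor field of type `(1, m)` is given in the chart by its components
`T^a_{b₀ ⋯ b_{m-1}}`, which are functions on (the target of the chart in) `ℝⁿ`. -/

/-- The components `T a b y = T^a_{b 0 ⋯ b (m-1)}(y)` of a tensor field of type `(1, m)`. -/
abbrev TensorComp (n m : ℕ) : Type :=
  Fin n → (Fin m → Fin n) → EuclideanSpace ℝ (Fin n) → ℝ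

/-- The partial derivative `∂f/∂y^b` of a function on `ℝⁿ`. -/
def partialD {n : ℕ} (b : Fin n) (f : EuclideanSpace ℝ (Fin n) → ℝ)
    (y : EuclideanSpace ℝ (Fin n)) : ℝ :=
  fderiv ℝ f y (EuclideanSpace.single b 1)

section Riemannian

variable {n : ℕ} {M : Type*} [MetricSpace M] [ChartedSpace (EuclideanSpace ℝ (Fin n)) M]
  [IsManifold (𝓡 n) ∞ M] [RiemannianBundle (fun x : M ↦ TangentSpace (𝓡 n) x)]

/-- The coordinate vector field `∂/∂y^a` of the chart `φ`, at the point with coordinates `y`. -/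
def coordVector (φ : OpenPartialHomeomorph M (EuclideanSpace ℝ (Fin n))) (a : Fin n)
    (y : EuclideanSpace ℝ (Fin n)) : TangentSpace (𝓡 n) (φ.symm y) :=
  mfderiv 𝓘(ℝ, EuclideanSpace ℝ (Fin n)) (𝓡 n) φ.symm y
    (EuclideanSpace.single a 1 : EuclideanSpace ℝ (Fin n))

/-- The matrix `g_{ab}(y)` of the metric in the chart `φ`. -/
def metricMatrix (φ : OpenPartialHomeomorph M (EuclideanSpace ℝ (Fin n)))
    (y : EuclideanSpace ℝ (Fin n)) : Matrix (Fin n) (Fin n) ℝ :=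
  Matrix.of fun a b ↦ inner ℝ (coordVector φ a y) (coordVector φ b y)

/-- The coefficients `Γ^a_{bc}(y)` of the Levi-Civita connection in the chart `φ`. -/
def christoffel (φ : OpenPartialHomeomorph M (EuclideanSpace ℝ (Fin n))) (a b c : Fin n)
    (y : EuclideanSpace ℝ (Fin n)) : ℝ :=
  (1 / 2 : ℝ) * ∑ d, (metricMatrix φ y)⁻¹ a d *
    (partialD c (fun z ↦ metricMatrix φ z b d) y + partialD b (fun z ↦ metricMatrix φ z d c) y
      - partialD d (fun z ↦ metricMatrix φ z b c) y)

/-- The components of the Riemann curvature tensor in the chart `φ`: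
`riemannComp φ a b = R^a_{b 0, b 1, b 2}`, where `R(∂_d, ∂_e) ∂_c = ∑ a, R^a_{cde} ∂_a`. -/
def riemannComp (φ : OpenPartialHomeomorph M (EuclideanSpace ℝ (Fin n))) : TensorComp n 3 :=
  fun a b y ↦
    partialD (b 1) (christoffel φ a (b 2) (b 0)) y
      - partialD (b 2) (christoffel φ a (b 1) (b 0)) y
      + ∑ s, (christoffel φ a (b 1) s y * christoffel φ s (b 2) (b 0) y
        - christoffel φ a (b 2) s y * christoffel φ s (b 1) (b 0) y)

/-- The Levi-Civita covariant derivative `∇T`, of type `(1, m + 1)`, of a tensor field `T` of type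
`(1, m)`, in the chart `φ`. The new lower index is the first one:
`(∇T)^a_{c b₀ ⋯} = ∂_c T^a_{b₀ ⋯} + ∑ s, Γ^a_{cs} T^s_{b₀ ⋯} - ∑ i, ∑ s, Γ^s_{c b_i} T^a_{⋯ s ⋯}`,
with `s` in the place of `b_i` in the last sum. -/
def covDeriv (φ : OpenPartialHomeomorph M (EuclideanSpace ℝ (Fin n))) {m : ℕ}
    (T : TensorComp n m) : TensorComp n (m + 1) :=
  fun a b y ↦
    partialD (b 0) (T a (Fin.tail b)) y
      + ∑ s, christoffel φ a (b 0) s y * T s (Fin.tail b) y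
      - ∑ i, ∑ s, christoffel φ s (b 0) (Fin.tail b i) y *
          T a (Function.update (Fin.tail b) i s) y

/-- The iterated Levi-Civita covariant derivative `∇^k T` in the chart `φ`. -/
def iterCovDeriv (φ : OpenPartialHomeomorph M (EuclideanSpace ℝ (Fin n))) {m : ℕ}
    (T : TensorComp n m) : (k : ℕ) → TensorComp n (m + k)
  | 0 => T
  | k + 1 => covDeriv φ (iterCovDeriv φ T k)

/-- The pointwise norm `‖T‖_g` of a tensor field of type `(1, m)`, in the chart `φ`: the square root
of `∑ g_{aa'} g^{b₀b₀'} ⋯ g^{b_{m-1}b_{m-1}'} T^a_{b₀ ⋯} T^{a'}_{b₀' ⋯}`. -/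
def tensorNorm (φ : OpenPartialHomeomorph M (EuclideanSpace ℝ (Fin n))) {m : ℕ}
    (T : TensorComp n m) (y : EuclideanSpace ℝ (Fin n)) : ℝ :=
  √(∑ a, ∑ a', ∑ b : Fin m → Fin n, ∑ b' : Fin m → Fin n,
    metricMatrix φ y a a' * (∏ i, (metricMatrix φ y)⁻¹ (b i) (b' i)) * T a b y * T a' b' y)

/-- The components `A^a(y)` in the chart `φ` of a vector field `A`, as a tensor field of type
`(1, 0)`. -/
def vectorComp (φ : OpenPartialHomeomorph M (EuclideanSpace ℝ (Fin n)))
    (A : (x : M) → TangentSpace (𝓡 n) x) : TensorComp n 0 :=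
  fun a _ y ↦
    let v : EuclideanSpace ℝ (Fin n) :=
      mfderiv (𝓡 n) 𝓘(ℝ, EuclideanSpace ℝ (Fin n)) φ (φ.symm y) (A (φ.symm y))
    v a

/-- The pointwise norm of `∇A` is at most `c` on all of `M`. The norm does not depend on the chart
in which it is computed, so that all smooth charts around a point may be used. -/
def CovDerivBoundedBy (A : (x : M) → TangentSpace (𝓡 n) x) (c : ℝ) : Prop :=
  ∀ φ ∈ IsManifold.maximalAtlas (𝓡 n) ∞ M, ∀ x ∈ φ.source,
    tensorNorm φ (covDeriv φ (vectorComp φ A)) (φ x) ≤ c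

/-- The pointwise norm of `∇^k R` is at most `c` on all of `M`, where `R` is the Riemann curvature
tensor. The norm does not depend on the chart in which it is computed, so that all smooth charts
around a point may be used. -/
def CurvatureDerivBoundedBy (n : ℕ) (M : Type*) [MetricSpace M]
    [ChartedSpace (EuclideanSpace ℝ (Fin n)) M] [IsManifold (𝓡 n) ∞ M]
    [RiemannianBundle (fun x : M ↦ TangentSpace (𝓡 n) x)] (k : ℕ) (c : ℝ) : Prop :=
  ∀ φ ∈ IsManifold.maximalAtlas (𝓡 n) ∞ M, ∀ x ∈ φ.source,
    tensorNorm φ (iterCovDeriv φ (riemannComp φ) k) (φ x) ≤ c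

/-! ## Geodesics, normal charts, injectivity radius -/

/-- `σ` is a geodesic on the open set `s` of times: it is smooth there and satisfies the geodesic
equation `σ''^a + ∑ Γ^a_{bc}(σ) σ'^b σ'^c = 0` in charts. -/
def IsGeodesicOn (σ : ℝ → M) (s : Set ℝ) : Prop :=
  ContMDiffOn 𝓘(ℝ, ℝ) (𝓡 n) ∞ σ s ∧
  ∀ φ ∈ IsManifold.maximalAtlas (𝓡 n) ∞ M, ∀ t ∈ s, σ t ∈ φ.source → ∀ a,
    deriv (deriv fun u ↦ φ (σ u) a) t
      + ∑ b, ∑ c, christoffel φ a b c (φ (σ t)) *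
          deriv (fun u ↦ φ (σ u) b) t * deriv (fun u ↦ φ (σ u) c) t = 0

/-- `exp_p v` is defined and equal to `q`: there is a geodesic on an open interval around `[0, 1]`
which starts at time `0` from `p` with velocity `v` and is at `q` at time `1`. -/
def IsExp (p : M) (v : TangentSpace (𝓡 n) p) (q : M) : Prop :=
  ∃ σ : ℝ → M, ∃ ε > 0, IsGeodesicOn (n := n) σ (Ioo (-ε) (1 + ε)) ∧
    (⟨σ 0, mfderiv 𝓘(ℝ, ℝ) (𝓡 n) σ 0 (1 : ℝ)⟩ : TangentBundle (𝓡 n) M) = ⟨p, v⟩ ∧ σ 1 = q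

/-- `φ` is a normal Riemannian chart centered at `p` whose domain is the open metric ball
of radius `r`: it is a smooth chart from this ball onto the ball of radius `r` around `0` in `ℝⁿ`,
and its inverse is `y ↦ exp_p (∑ j, y^j e_j)` for an orthonormal basis `e` of `T_p M`. -/
def IsNormalChart (φ : OpenPartialHomeomorph M (EuclideanSpace ℝ (Fin n))) (p : M) (r : ℝ) : Prop :=
  φ ∈ IsManifold.maximalAtlas (𝓡 n) ∞ M ∧
  φ.source = Metric.ball p r ∧
  φ.target = Metric.ball 0 r ∧
  ∃ e : OrthonormalBasis (Fin n) ℝ (TangentSpace (𝓡 n) p),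
    ∀ y ∈ φ.target, IsExp p (∑ j, y j • e j) (φ.symm y)

/-- The injectivity radius at `p`, possibly infinite. -/
def injectivityRadiusAt (n : ℕ) {M : Type*} [MetricSpace M]
    [ChartedSpace (EuclideanSpace ℝ (Fin n)) M] [IsManifold (𝓡 n) ∞ M]
    [RiemannianBundle (fun x : M ↦ TangentSpace (𝓡 n) x)] (p : M) : ℝ≥0∞ :=
  sSup {ρ | ∃ r : ℝ, 0 < r ∧ ρ = ENNReal.ofReal r ∧
    ∃ φ : OpenPartialHomeomorph M (EuclideanSpace ℝ (Fin n)), IsNormalChart φ p r}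

/-- The injectivity radius of `M`, possibly infinite. -/
def injectivityRadius (n : ℕ) (M : Type*) [MetricSpace M]
    [ChartedSpace (EuclideanSpace ℝ (Fin n)) M] [IsManifold (𝓡 n) ∞ M]
    [RiemannianBundle (fun x : M ↦ TangentSpace (𝓡 n) x)] : ℝ≥0∞ :=
  ⨅ p : M, injectivityRadiusAt n p

/-- A Riemannian manifold is of bounded geometry if its injectivity radius is positive and, for
every `k`, the norm of the `k`-th covariant derivative of the curvature tensor is bounded. -/
structure IsOfBoundedGeometry (n : ℕ) (M : Type*) [MetricSpace M]
    [ChartedSpace (EuclideanSpace ℝ (Fin n)) M] [IsManifold (𝓡 n) ∞ M]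
    [RiemannianBundle (fun x : M ↦ TangentSpace (𝓡 n) x)] : Prop where
  injectivityRadius_pos : 0 < injectivityRadius n M
  curvature_bounded : ∀ k : ℕ, ∃ c : ℝ, CurvatureDerivBoundedBy n M k c

end Riemannian

end

/-! Everything is read off in normal charts, whose radii all exceed a fixed ρ > 0 because the
injectivity radius is positive. By the Gauss lemma (`IsNormalMetric.gauss`) the norm of the normal
coordinates y changes along a curve no faster than its Riemannian speed. So an integral curve of A
from the centre cannot leave the chart before time ρ/(2c₁), and it exists until then
(`exists_hasDerivAt_of_inner_le`). This time is the same for every starting point, hence integral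
curves extend to ℝ. The same estimate along arbitrary curves shows that ‖y‖ is the distance to the
centre (`IsNormalChart.dist_eq`).

For the growth of the distance, let y(t) be the normal coordinates of γ(t) at γ(0). Half the
derivative of ‖y‖² is H = ⟨y, A(y)⟩, with H(0) = 0, and H' = Hess(‖y‖²/2)(A, A) + g(y, ∇_A A). A
curvature bound makes the Hessian at least g/2 near the centre, by a Jacobi field comparison
(`IsNormalMetric.half_le_hessian`). The second term is at most c₂‖y‖|A|. Grönwall's inequality keeps
|A| within a factor two of |A(γ(0))| for a short time, so ‖y‖ ≤ 2|A(γ(0))|t, and the second term is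
absorbed by the first however small A(γ(0)) is. Hence H' is at least a constant times
|A(γ(t))||A(γ(0))| (`IsNormalMetric.radial_growth`), which gives monotonicity, strict if A(γ(0)) ≠
0, up to a time depending only on ρ, c₁, c₂ and the curvature bound.

This calculus is done for an abstract metric on a ball. `IsNormalChart.isNormalMetric` shows that
normal charts provide one, using uniqueness of geodesics (`IsGeodesicOn.eqOn`);
`tensor_contraction_le` turns the bounds on tensor norms into bounds on values. -/

noncomputable section

set_option synthInstance.maxHeartbeats 200000

/-! ## Metrics in normal coordinates -/

section NormalMetric

variable {E : Type*} [NormedAddCommGroup E] [InnerProductSpace ℝ E]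

/-- `g` is a Riemannian metric on the ball of radius `r` of `E`, with Levi-Civita connection `Γ`,
which agrees with the inner product at `0` and for which the rays from `0` are geodesics. -/
structure IsNormalMetric (g : E → E →L[ℝ] E →L[ℝ] ℝ) (Γ : E → E →L[ℝ] E →L[ℝ] E) (r : ℝ) :
    Prop where
  differentiableAt : ∀ y ∈ Metric.ball (0 : E) r, DifferentiableAt ℝ g y
  differentiableAt_connection : ∀ y ∈ Metric.ball (0 : E) r, DifferentiableAt ℝ Γ y
  symm : ∀ y ∈ Metric.ball (0 : E) r, ∀ u v, g y u v = g y v u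
  pos : ∀ y ∈ Metric.ball (0 : E) r, ∀ v, v ≠ 0 → 0 < g y v v
  connection_symm : ∀ y ∈ Metric.ball (0 : E) r, ∀ u v, Γ y u v = Γ y v u
  koszul : ∀ y ∈ Metric.ball (0 : E) r, ∀ u v w,
    2 * g y (Γ y u v) w = fderiv ℝ g y v u w + fderiv ℝ g y u w v - fderiv ℝ g y w u v
  geodesic : ∀ y ∈ Metric.ball (0 : E) r, Γ y y y = 0
  at_zero : ∀ u v, g 0 u v = inner ℝ u v

variable {g : E → E →L[ℝ] E →L[ℝ] ℝ} {Γ : E → E →L[ℝ] E →L[ℝ] E} {r : ℝ}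

lemma hasDerivAt_bilin {F G : Type*} [NormedAddCommGroup F] [NormedSpace ℝ F]
    [NormedAddCommGroup G] [NormedSpace ℝ G]
    {B : E → F →L[ℝ] F →L[ℝ] G} {σ : ℝ → E} {X Y : ℝ → F} {σ' : E} {X' Y' : F} {t : ℝ}
    (hB : DifferentiableAt ℝ B (σ t)) (hσ : HasDerivAt σ σ' t) (hX : HasDerivAt X X' t)
    (hY : HasDerivAt Y Y' t) :
    HasDerivAt (fun s ↦ B (σ s) (X s) (Y s))
      (fderiv ℝ B (σ t) σ' (X t) (Y t) + B (σ t) X' (Y t) + B (σ t) (X t) Y') t := by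
  have h1 : HasDerivAt (fun s ↦ B (σ s)) (fderiv ℝ B (σ t) σ') t :=
    HasFDerivAt.comp_hasDerivAt (E := F →L[ℝ] F →L[ℝ] G) t hB.hasFDerivAt hσ
  have h2 := (h1.clm_apply hX).clm_apply hY
  simpa using h2

lemma fderiv_bilin_apply {E F G : Type*} [NormedAddCommGroup E] [NormedSpace ℝ E]
    [NormedAddCommGroup F] [NormedSpace ℝ F] [NormedAddCommGroup G] [NormedSpace ℝ G]
    {B : E → F →L[ℝ] F →L[ℝ] G} {y : E} (hB : DifferentiableAt ℝ B y) (v : E) (a b : F) :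
    fderiv ℝ B y v a b = fderiv ℝ (fun z ↦ B z a b) y v := by
  have := ((hB.hasFDerivAt.clm_apply (hasFDerivAt_const a y)).clm_apply
    (hasFDerivAt_const b y)).fderiv
  rw [this]
  simp

namespace IsNormalMetric

variable (h : IsNormalMetric g Γ r)
include h

lemma fderiv_symm {y : E} (hy : y ∈ Metric.ball (0 : E) r) (v a b : E) :
    fderiv ℝ g y v a b = fderiv ℝ g y v b a := by
  rw [fderiv_bilin_apply (h.differentiableAt y hy), fderiv_bilin_apply (h.differentiableAt y hy)]
  have : (fun z ↦ g z a b) =ᶠ[𝓝 y] fun z ↦ g z b a := by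
    filter_upwards [Metric.isOpen_ball.mem_nhds hy] with z hz using h.symm z hz a b
  rw [this.fderiv_eq]

/-- Metric compatibility: add the Koszul formulas for (v, u, w) and (v, w, u); by symmetry of g only
the derivative along v survives. -/
lemma fderiv_eq_connection {y : E} (hy : y ∈ Metric.ball (0 : E) r) (v u w : E) :
    fderiv ℝ g y v u w = g y (Γ y v u) w + g y u (Γ y v w) := by
  have h1 := h.koszul y hy v u w
  have h2 := h.koszul y hy v w u
  rw [h.symm y hy u]
  have h3 := h.fderiv_symm hy v w u
  have h4 := h.fderiv_symm hy u w v
  have h5 := h.fderiv_symm hy w v u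
  linarith

lemma nonneg {y : E} (hy : y ∈ Metric.ball (0 : E) r) (v : E) : 0 ≤ g y v v := by
  rcases eq_or_ne v 0 with rfl | hv
  · simp
  · exact (h.pos y hy v hv).le

/-- Cauchy–Schwarz, from positivity of g at g(v,v)u − g(u,v)v. -/
lemma sq_le {y : E} (hy : y ∈ Metric.ball (0 : E) r) (u v : E) :
    (g y u v) ^ 2 ≤ g y u u * g y v v := by
  rcases eq_or_ne v 0 with rfl | hv
  · simp
  have hp := h.pos y hy v hv
  have h0 := h.nonneg hy (g y v v • u - g y u v • v)
  simp only [map_sub, map_smul, sub_apply, smul_apply,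
    smul_eq_mul, h.symm y hy v u] at h0
  nlinarith [mul_pos hp hp]

lemma abs_le {y : E} (hy : y ∈ Metric.ball (0 : E) r) (u v : E) :
    |g y u v| ≤ √(g y u u) * √(g y v v) := by
  rw [← Real.sqrt_mul (h.nonneg hy u)]
  exact Real.abs_le_sqrt (h.sq_le hy u v)

lemma hasDerivAt_metric {σ X Y : ℝ → E} {σ' X' Y' : E} {t : ℝ}
    (hy : σ t ∈ Metric.ball (0 : E) r) (hσ : HasDerivAt σ σ' t) (hX : HasDerivAt X X' t)
    (hY : HasDerivAt Y Y' t) :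
    HasDerivAt (fun s ↦ g (σ s) (X s) (Y s))
      (g (σ t) (X' + Γ (σ t) σ' (X t)) (Y t) + g (σ t) (X t) (Y' + Γ (σ t) σ' (Y t))) t := by
  refine (hasDerivAt_bilin (h.differentiableAt _ hy) hσ hX hY).congr_deriv ?_
  rw [h.fderiv_eq_connection hy]
  simp only [map_add, add_apply]
  ring

omit h in
lemma smul_mem_ball {y : E} (hy : y ∈ Metric.ball (0 : E) r) {t : ℝ} (ht : t ∈ Icc (0 : ℝ) 1) :
    t • y ∈ Metric.ball (0 : E) r := by
  rw [mem_ball_zero_iff] at *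
  rw [norm_smul, Real.norm_of_nonneg ht.1]
  exact (mul_le_of_le_one_left (norm_nonneg _) ht.2).trans_lt hy

omit h in
lemma hasDerivAt_ray (y : E) (t : ℝ) : HasDerivAt (fun s : ℝ ↦ s • y) y t := by
  simpa using (hasDerivAt_id t).smul_const y

lemma geodesic_smul {y : E} (hy : y ∈ Metric.ball (0 : E) r) {t : ℝ} (ht : t ∈ Ioc (0 : ℝ) 1) :
    Γ (t • y) y y = 0 := by
  have := h.geodesic _ (smul_mem_ball hy ⟨ht.1.le, ht.2⟩)
  simpa [ht.1.ne'] using this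

-- Vanishing is asked only in the interior: at the origin the condition Γ(y, y) = 0 is empty, so
-- nothing is known there for a general direction.
omit h in
lemma eq_of_hasDerivAt_zero {f f' : ℝ → ℝ} (hf : ∀ t ∈ Icc (0 : ℝ) 1, HasDerivAt f (f' t) t)
    (h0 : ∀ t ∈ Ioo (0 : ℝ) 1, f' t = 0) : f 1 = f 0 := by
  obtain ⟨c, hc, h1⟩ := exists_hasDerivAt_eq_slope f f' zero_lt_one
    (fun t ht ↦ (hf t ht).continuousAt.continuousWithinAt)
    (fun t ht ↦ hf t (Ioo_subset_Icc_self ht))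
  rw [h0 c hc] at h1
  linarith

/-- The rays from `0` have constant speed. -/
lemma apply_self {y : E} (hy : y ∈ Metric.ball (0 : E) r) : g y y y = inner ℝ y y := by
  have key := eq_of_hasDerivAt_zero (f := fun t : ℝ ↦ g (t • y) y y)
    (fun t ht ↦ h.hasDerivAt_metric (smul_mem_ball hy ht) (hasDerivAt_ray y t)
      (hasDerivAt_const t y) (hasDerivAt_const t y))
    (fun t ht ↦ by simp [h.geodesic_smul hy ⟨ht.1, ht.2.le⟩])
  simpa [h.at_zero] using key

/-- Differentiate the identity g_y(y, y) = ⟨y, y⟩ in the direction w. -/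
lemma fderiv_apply_self {y : E} (hy : y ∈ Metric.ball (0 : E) r) (w : E) :
    fderiv ℝ g y w y y + 2 * g y y w = 2 * inner ℝ y w := by
  have h1 : HasDerivAt (fun s : ℝ ↦ y + s • w) w 0 := by
    simpa using (hasDerivAt_ray w 0).const_add y
  have h2 := hasDerivAt_bilin (B := g) (t := 0) (by simpa using h.differentiableAt y hy) h1 h1 h1
  have h3 : HasDerivAt (fun s : ℝ ↦ (inner ℝ (y + s • w) (y + s • w) : ℝ))
      (inner ℝ (y + (0 : ℝ) • w) w + inner ℝ w (y + (0 : ℝ) • w)) 0 := h1.inner ℝ h1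
  have h4 : (fun s : ℝ ↦ g (y + s • w) (y + s • w) (y + s • w)) =ᶠ[𝓝 0]
      fun s : ℝ ↦ inner ℝ (y + s • w) (y + s • w) := by
    have : ∀ᶠ s : ℝ in 𝓝 0, y + s • w ∈ Metric.ball (0 : E) r :=
      h1.continuousAt.eventually_mem (by simpa using Metric.isOpen_ball.mem_nhds hy)
    filter_upwards [this] with s hs using h.apply_self hs
  have h5 := (h3.congr_of_eventuallyEq h4).unique h2
  simp only [zero_smul, add_zero] at h5
  rw [h.symm y hy w y, real_inner_comm] at h5
  rw [real_inner_comm]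
  linarith

/-- The **Gauss lemma**. -/
lemma gauss {y : E} (hy : y ∈ Metric.ball (0 : E) r) (w : E) : g y y w = inner ℝ y w := by
  have key := eq_of_hasDerivAt_zero (f := fun t : ℝ ↦ g (t • y) (t • y) w - t * inner ℝ y w)
    (fun t ht ↦ (hasDerivAt_bilin (h.differentiableAt _ (smul_mem_ball hy ht)) (hasDerivAt_ray y t)
      (hasDerivAt_ray y t) (hasDerivAt_const t w)).sub ((hasDerivAt_id t).mul_const _))
    (fun t ht ↦ by
      have hY := smul_mem_ball hy (Ioo_subset_Icc_self ht)
      have h1 := h.fderiv_apply_self hY w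
      -- At Y = ty the term Γ(Y, Y) drops out, so Koszul reads 2 ∂_Y g(Y, w) = ∂_w g(Y, Y). With
      -- `h1` this is t times the vanishing of the derivative.
      have h2 := h.koszul _ hY (t • y) (t • y) w
      rw [h.geodesic _ hY, h.fderiv_symm hY (t • y) w] at h2
      simp only [map_smul, smul_apply, smul_eq_mul, map_zero,
        zero_apply, inner_smul_left, conj_trivial] at h1 h2 ⊢
      have := ht.1
      apply mul_left_cancel₀ this.ne'
      linarith)
  simpa [sub_eq_zero] using key

/-- Differentiate the Gauss identity g_y(y, w) = ⟨y, w⟩ in the direction u. -/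
lemma fderiv_gauss {y : E} (hy : y ∈ Metric.ball (0 : E) r) (u w : E) :
    fderiv ℝ g y u y w + g y u w = inner ℝ u w := by
  have h1 : HasDerivAt (fun s : ℝ ↦ y + s • u) u 0 := by
    simpa using (hasDerivAt_ray u 0).const_add y
  have h2 := hasDerivAt_bilin (B := g) (t := 0) (by simpa using h.differentiableAt y hy) h1 h1
    (hasDerivAt_const 0 w)
  have h3 := h1.inner ℝ (hasDerivAt_const 0 w)
  have h4 : (fun s : ℝ ↦ g (y + s • u) (y + s • u) w) =ᶠ[𝓝 0]
      fun s : ℝ ↦ inner ℝ (y + s • u) w := by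
    have : ∀ᶠ s : ℝ in 𝓝 0, y + s • u ∈ Metric.ball (0 : E) r :=
      h1.continuousAt.eventually_mem (by simpa using Metric.isOpen_ball.mem_nhds hy)
    filter_upwards [this] with s hs using h.gauss hs w
  have h5 := (h3.congr_of_eventuallyEq h4).unique h2
  simp only [zero_smul, add_zero, map_zero, inner_zero_right, zero_add] at h5
  linarith

/-- The Hessian of half the squared distance to `0`. -/
lemma hessian_eq {y : E} (hy : y ∈ Metric.ball (0 : E) r) (u : E) :
    inner ℝ u u - inner ℝ y (Γ y u u) = g y u u + 1 / 2 * fderiv ℝ g y y u u := by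
  have h1 := h.koszul y hy u u y
  have h2 := h.fderiv_gauss hy u u
  rw [h.symm y hy _ y, h.gauss hy, h.fderiv_symm hy u u y] at h1
  linarith

end IsNormalMetric

/-- The curvature `R(v, w)u` of a connection `Γ`. -/
def connectionCurvature (Γ : E → E →L[ℝ] E →L[ℝ] E) (y u v w : E) : E :=
  fderiv ℝ Γ y v w u - fderiv ℝ Γ y w v u + Γ y v (Γ y w u) - Γ y w (Γ y v u)

/-! ### Curvature along rays and Hessian comparison -/

namespace IsNormalMetric

variable (h : IsNormalMetric g Γ r)
include h

/-- Differentiating Γ_y(y, y) = 0 trades the derivative of Γ transverse to a ray for Γ itself; this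
is what produces the Jacobi equation below. -/
lemma fderiv_geodesic {y : E} (hy : y ∈ Metric.ball (0 : E) r) (w : E) :
    fderiv ℝ Γ y w y y + 2 • Γ y y w = 0 := by
  have h1 : HasDerivAt (fun s : ℝ ↦ y + s • w) w 0 := by
    simpa using (hasDerivAt_ray w 0).const_add y
  have h2 := hasDerivAt_bilin (B := Γ) (t := 0)
    (by simpa using h.differentiableAt_connection y hy) h1 h1 h1
  have h4 : (fun s : ℝ ↦ Γ (y + s • w) (y + s • w) (y + s • w)) =ᶠ[𝓝 0] fun _ ↦ 0 := by
    have : ∀ᶠ s : ℝ in 𝓝 0, y + s • w ∈ Metric.ball (0 : E) r :=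
      h1.continuousAt.eventually_mem (by simpa using Metric.isOpen_ball.mem_nhds hy)
    filter_upwards [this] with s hs using h.geodesic _ hs
  have h5 := ((hasDerivAt_const (0 : ℝ) (0 : E)).congr_of_eventuallyEq h4).unique h2
  simp only [zero_smul, add_zero] at h5
  rw [h.connection_symm y hy w y] at h5
  rw [two_smul, ← add_assoc, ← h5]

/-- Hessian comparison: under an upper curvature bound, half the squared distance to `0` is
uniformly convex close to `0`. -/
lemma half_le_hessian {K : ℝ} (hK : 0 ≤ K)
    (hR : ∀ y ∈ Metric.ball (0 : E) r, ∀ v w,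
      |g y w (connectionCurvature Γ y v v w)| ≤ K * g y v v * g y w w)
    {y : E} (hy : y ∈ Metric.ball (0 : E) r) (hKy : K * ‖y‖ ^ 2 < 1 / 4) (w : E) :
    1 / 2 * g y w w ≤ inner ℝ w w - inner ℝ y (Γ y w w) := by
  rcases eq_or_ne w 0 with rfl | hw
  · simp
  rw [h.hessian_eq hy]
  -- The field tw along the ray ty is the Jacobi field vanishing at 0, and P = w + tΓ(y, w) is its
  -- covariant derivative.
  have hP (t : ℝ) (ht : t ∈ Icc (0 : ℝ) 1) : HasDerivAt (fun t : ℝ ↦ w + t • Γ (t • y) y w)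
      (Γ (t • y) y w + t • fderiv ℝ Γ (t • y) y y w) t := by
    have := ((hasDerivAt_id t).smul (hasDerivAt_bilin
      (h.differentiableAt_connection _ (smul_mem_ball hy ht)) (hasDerivAt_ray y t)
      (hasDerivAt_const t y) (hasDerivAt_const t w))).const_add w
    refine this.congr_deriv ?_
    simp [add_comm]
  have hq (t : ℝ) (ht : t ∈ Icc (0 : ℝ) 1) := h.hasDerivAt_metric (smul_mem_ball hy ht)
    (hasDerivAt_ray y t) (hasDerivAt_const t w) (hasDerivAt_const t w)
  have hs (t : ℝ) (ht : t ∈ Icc (0 : ℝ) 1) := h.hasDerivAt_metric (smul_mem_ball hy ht)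
    (hasDerivAt_ray y t) (hasDerivAt_const t w) (hP t ht)
  have hpos (t : ℝ) (ht : t ∈ Icc (0 : ℝ) 1) := h.pos _ (smul_mem_ball hy ht) w hw
  -- With q = g(w, w), the claim q/2 ≤ g(w, P) is strict at t = 0, and at t = 1 it is the desired
  -- bound. It suffices that at any time of equality the right side grows strictly faster.
  have key := image_le_of_deriv_right_lt_deriv_boundary' (a := 0) (b := 1)
    (f := fun t : ℝ ↦ 1 / 2 * g (t • y) w w)
    (B := fun t : ℝ ↦ g (t • y) w (w + t • Γ (t • y) y w))
    (fun t ht ↦ ((hq t ht).const_mul (1 / 2 : ℝ)).continuousAt.continuousWithinAt)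
    (fun t ht ↦ ((hq t (Ico_subset_Icc_self ht)).const_mul (1 / 2 : ℝ)).hasDerivWithinAt)
    (by have := hpos 0 (by simp); simp at this ⊢; linarith)
    (fun t ht ↦ (hs t ht).continuousAt.continuousWithinAt)
    (fun t ht ↦ (hs t (Ico_subset_Icc_self ht)).hasDerivWithinAt)
    (by
      intro t ht heq
      have ht' := Ico_subset_Icc_self ht
      have hY := smul_mem_ball hy ht'
      have hq0 := hpos t ht'
      have ht0 : 0 < t := by
        rcases ht.1.eq_or_lt with h0 | h0
        · subst h0
          simp at heq hq0
          linarith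
        · exact h0
      set P := w + t • Γ (t • y) y w with hPdef
      -- The Jacobi equation: the covariant derivative of P is tR(y, w)y.
      have hnab : Γ (t • y) y w + t • fderiv ℝ Γ (t • y) y y w + Γ (t • y) y P
          = t • connectionCurvature Γ (t • y) y y w := by
        have h1 := h.fderiv_geodesic hY w
        have h2 : t • fderiv ℝ Γ (t • y) w y y + 2 • Γ (t • y) y w = 0 := by
          have : t • (t • fderiv ℝ Γ (t • y) w y y + 2 • Γ (t • y) y w) = 0 := by
            rw [← h1]
            simp only [map_smul, smul_apply, smul_add, add_right_inj]
            exact smul_comm _ _ _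
          exact (smul_eq_zero.1 this).resolve_left ht0.ne'
        have h3 : fderiv ℝ Γ (t • y) y w y = fderiv ℝ Γ (t • y) y y w := by
          rw [fderiv_bilin_apply (h.differentiableAt_connection _ hY),
            fderiv_bilin_apply (h.differentiableAt_connection _ hY)]
          have : (fun z ↦ Γ z w y) =ᶠ[𝓝 (t • y)] fun z ↦ Γ z y w := by
            filter_upwards [Metric.isOpen_ball.mem_nhds hY] with z hz
              using h.connection_symm z hz w y
          rw [this.fderiv_eq]
        rw [connectionCurvature, h3, h.geodesic_smul hy ⟨ht0, ht.2.le⟩, hPdef,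
          h.connection_symm _ hY w y]
        simp only [map_add, map_smul, map_zero, sub_zero, smul_add, smul_sub]
        have h4 : t • fderiv ℝ Γ (t • y) w y y = - (2 • Γ (t • y) y w) :=
          eq_neg_of_add_eq_zero_left h2
        rw [h4]
        module
      have hw' : t • Γ (t • y) y w = P - w := by simp [hPdef]
      have hR' := (_root_.abs_le.1 (hR _ hY y w)).1
      have hyy : g (t • y) y y = ‖y‖ ^ 2 := by
        have := h.apply_self hY
        simp only [map_smul, smul_apply, smul_eq_mul, inner_smul_left,
          inner_smul_right, conj_trivial, real_inner_self_eq_norm_sq] at this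
        have h2 : t * t * g (t • y) y y = t * t * ‖y‖ ^ 2 := by linarith
        exact mul_left_cancel₀ (mul_pos ht0 ht0).ne' h2
      rw [hyy] at hR'
      rw [hnab]
      simp only [map_smul, zero_add, smul_eq_mul]
      have e1 : t * g (t • y) (Γ (t • y) y w) w = g (t • y) w P - g (t • y) w w := by
        have := congrArg (fun z ↦ g (t • y) z w) hw'
        simp only [map_smul, smul_apply, smul_eq_mul, map_sub,
          sub_apply] at this
        rw [this, h.symm _ hY P w]
      have e2 : t * g (t • y) (Γ (t • y) y w) P = g (t • y) P P - g (t • y) w P := by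
        have := congrArg (fun z ↦ g (t • y) z P) hw'
        simpa only [map_smul, smul_apply, smul_eq_mul, map_sub,
          sub_apply] using this
      have e3 := h.sq_le hY w P
      rw [h.symm _ hY w (Γ (t • y) y w)]
      have heq' : g (t • y) w P = 1 / 2 * g (t • y) w w := heq.symm
      -- At equality g(w, P) = q/2, so Cauchy–Schwarz gives |P|² ≥ q/4, and |P − w|² = |P|². Hence t
      -- times the difference of the derivatives is |P|² + t²g(w, R(y, w)y), positive since K‖y‖² <
      -- 1/4.
      have hPP : 1 / 4 * g (t • y) w w ≤ g (t • y) P P := by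
        rw [heq'] at e3
        nlinarith
      apply lt_of_mul_lt_mul_left _ ht0.le
      have e4 : t * t * (K * ‖y‖ ^ 2 * g (t • y) w w) < 1 / 4 * g (t • y) w w := by
        have a1 : t * t ≤ 1 := by nlinarith [ht.2]
        have a2 : K * ‖y‖ ^ 2 * g (t • y) w w < 1 / 4 * g (t • y) w w := by gcongr
        have a3 : 0 ≤ K * ‖y‖ ^ 2 * g (t • y) w w := by positivity
        nlinarith
      have e5 : t * t * -(K * ‖y‖ ^ 2 * g (t • y) w w)
          ≤ t * t * g (t • y) w (connectionCurvature Γ (t • y) y y w) := by gcongr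
      nlinarith)
  have := key (right_mem_Icc.2 zero_le_one)
  simp only [one_smul, map_add] at this
  have e := h.fderiv_eq_connection hy y w w
  rw [h.symm y hy _ w] at e
  linarith

end IsNormalMetric

end NormalMetric

/-! ### Growth of the norm along integral curves of a vector field -/

section RadialGrowth

variable {E : Type*} [NormedAddCommGroup E] [InnerProductSpace ℝ E]

/-- The norm is not differentiable at 0, where the curve starts; the regularisation √(‖y‖² + δ²) is,
and its derivative is still at most B. -/
lemma sqrt_add_sq_le_of_inner_deriv_le {y y' : ℝ → E} {T B δ : ℝ} (hδ : 0 < δ) (h0 : y 0 = 0)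
    (hB : 0 ≤ B) (hy : ∀ t ∈ Icc 0 T, HasDerivAt y (y' t) t)
    (hle : ∀ t ∈ Icc 0 T, inner ℝ (y t) (y' t) ≤ B * ‖y t‖) {t : ℝ} (ht : t ∈ Icc 0 T) :
    √(‖y t‖ ^ 2 + δ ^ 2) ≤ δ + B * t := by
  have hd (t : ℝ) (ht : t ∈ Icc 0 T) : HasDerivAt (fun t ↦ √(‖y t‖ ^ 2 + δ ^ 2))
      ((2 * inner ℝ (y t) (y' t)) / (2 * √(‖y t‖ ^ 2 + δ ^ 2))) t :=
    ((hy t ht).norm_sq.add_const (δ ^ 2)).sqrt (by positivity)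
  have key := image_le_of_deriv_right_le_deriv_boundary (a := 0) (b := T)
    (f := fun t ↦ √(‖y t‖ ^ 2 + δ ^ 2)) (B := fun t ↦ δ + B * t) (B' := fun _ ↦ B)
    (fun t ht ↦ (hd t ht).continuousAt.continuousWithinAt)
    (fun t ht ↦ (hd t (Ico_subset_Icc_self ht)).hasDerivWithinAt)
    (by simp [h0, Real.sqrt_sq hδ.le])
    (by fun_prop)
    (fun t _ ↦ by simpa using (((hasDerivAt_id t).const_mul B).const_add δ).hasDerivWithinAt)
    (fun t ht ↦ by
      have hpos : 0 < √(‖y t‖ ^ 2 + δ ^ 2) := by positivity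
      rw [div_le_iff₀ (by positivity)]
      have h1 := hle t (Ico_subset_Icc_self ht)
      have h2 : ‖y t‖ ≤ √(‖y t‖ ^ 2 + δ ^ 2) := Real.le_sqrt_of_sq_le (by nlinarith)
      nlinarith)
  exact key ht

lemma norm_le_of_inner_deriv_le {y y' : ℝ → E} {T B : ℝ} (h0 : y 0 = 0)
    (hB : 0 ≤ B) (hy : ∀ t ∈ Icc 0 T, HasDerivAt y (y' t) t)
    (hle : ∀ t ∈ Icc 0 T, inner ℝ (y t) (y' t) ≤ B * ‖y t‖) {t : ℝ} (ht : t ∈ Icc 0 T) :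
    ‖y t‖ ≤ B * t := by
  apply le_of_forall_pos_le_add
  intro δ hδ
  have h1 := sqrt_add_sq_le_of_inner_deriv_le hδ h0 hB hy hle ht
  have h2 : ‖y t‖ ≤ √(‖y t‖ ^ 2 + δ ^ 2) := Real.le_sqrt_of_sq_le (by nlinarith)
  linarith

variable {g : E → E →L[ℝ] E →L[ℝ] ℝ} {Γ : E → E →L[ℝ] E →L[ℝ] E} {r : ℝ}

/-- Grönwall: N exp(−ct) does not increase. No sign is imposed on N or c, so applying it to −N
yields lower bounds as well. -/
lemma mul_exp_le_of_deriv {N N' : ℝ → ℝ} {T c : ℝ}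
    (hN : ∀ t ∈ Icc 0 T, HasDerivAt N (N' t) t) (hle : ∀ t ∈ Icc 0 T, N' t ≤ c * N t)
    {t : ℝ} (ht : t ∈ Icc 0 T) : N t ≤ N 0 * Real.exp (c * t) := by
  have hd (t : ℝ) (ht : t ∈ Icc 0 T) : HasDerivAt (fun t ↦ N t * Real.exp (-(c * t)))
      (N' t * Real.exp (-(c * t)) + N t * (Real.exp (-(c * t)) * -(c * 1))) t :=
    (hN t ht).mul (((hasDerivAt_id t).const_mul c).neg.exp)
  have key := image_le_of_deriv_right_le_deriv_boundary (a := 0) (b := T)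
    (f := fun t ↦ N t * Real.exp (-(c * t))) (B := fun t ↦ N 0) (B' := fun _ ↦ 0)
    (fun t ht ↦ (hd t ht).continuousAt.continuousWithinAt)
    (fun t ht ↦ (hd t (Ico_subset_Icc_self ht)).hasDerivWithinAt)
    (by simp) (by fun_prop) (fun t _ ↦ hasDerivWithinAt_const _ _ _)
    (fun t ht ↦ by
      have h1 := hle t (Ico_subset_Icc_self ht)
      have h2 := Real.exp_pos (-(c * t))
      nlinarith)
  have h1 := key ht
  rw [Real.exp_neg, ← div_eq_mul_inv, div_le_iff₀ (Real.exp_pos _)] at h1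
  exact h1

namespace IsNormalMetric

variable (h : IsNormalMetric g Γ r)
include h

/-- The distance to `0` increases for a short time along the integral curves from `0` of a vector
field whose covariant derivative is bounded. -/
theorem radial_growth {K c T : ℝ} (hK : 0 ≤ K)
    (hR : ∀ y ∈ Metric.ball (0 : E) r, ∀ v w,
      |g y w (connectionCurvature Γ y v v w)| ≤ K * g y v v * g y w w)
    {A : E → E} (hA : ∀ y ∈ Metric.ball (0 : E) r, DifferentiableAt ℝ A y) (hc : 0 < c)
    (hAc : ∀ y ∈ Metric.ball (0 : E) r, ∀ v,
      √(g y (fderiv ℝ A y v + Γ y v (A y)) (fderiv ℝ A y v + Γ y v (A y))) ≤ c * √(g y v v))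
    {y : ℝ → E} (hy : ∀ t ∈ Icc 0 T, HasDerivAt y (A (y t)) t) (h0 : y 0 = 0)
    (hyr : ∀ t ∈ Icc 0 T, y t ∈ Metric.ball (0 : E) r)
    (hyK : ∀ t ∈ Icc 0 T, K * ‖y t‖ ^ 2 < 1 / 4) (hT : c * T ≤ 1 / 32) :
    MonotoneOn (fun t ↦ ‖y t‖) (Icc 0 T) ∧
      (A 0 ≠ 0 → StrictMonoOn (fun t ↦ ‖y t‖) (Icc 0 T)) := by
  rcases lt_or_ge T 0 with hT0 | hT0
  · simp [Icc_eq_empty_of_lt hT0, MonotoneOn, StrictMonoOn]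
  have h0T : (0 : ℝ) ∈ Icc 0 T := left_mem_Icc.2 hT0
  set N : ℝ → ℝ := fun t ↦ g (y t) (A (y t)) (A (y t)) with hNdef
  set D : ℝ → E := fun t ↦ fderiv ℝ A (y t) (A (y t)) + Γ (y t) (A (y t)) (A (y t)) with hDdef
  have hN0 (t : ℝ) (ht : t ∈ Icc 0 T) : 0 ≤ N t := h.nonneg (hyr t ht) _
  have hAy (t : ℝ) (ht : t ∈ Icc 0 T) :
      HasDerivAt (fun t ↦ A (y t)) (fderiv ℝ A (y t) (A (y t))) t :=
    (hA _ (hyr t ht)).hasFDerivAt.comp_hasDerivAt t (hy t ht)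
  have hNd (t : ℝ) (ht : t ∈ Icc 0 T) : HasDerivAt N (2 * g (y t) (D t) (A (y t))) t := by
    refine (h.hasDerivAt_metric (hyr t ht) (hy t ht) (hAy t ht) (hAy t ht)).congr_deriv ?_
    rw [h.symm _ (hyr t ht) (A (y t))]
    ring
  have hDc (t : ℝ) (ht : t ∈ Icc 0 T) (u : E) : |g (y t) (D t) u| ≤ c * √(N t) * √(g (y t) u u) :=
    (h.abs_le (hyr t ht) _ _).trans
      (mul_le_mul_of_nonneg_right (hAc _ (hyr t ht) _) (Real.sqrt_nonneg _))
  have hNle (t : ℝ) (ht : t ∈ Icc 0 T) : |2 * g (y t) (D t) (A (y t))| ≤ 2 * c * N t := by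
    have := hDc t ht (A (y t))
    rw [mul_assoc, ← Real.sqrt_mul (hN0 t ht), Real.sqrt_mul_self (hN0 t ht)] at this
    rw [abs_mul, abs_two]
    linarith
  have hup (t : ℝ) (ht : t ∈ Icc 0 T) : N t ≤ N 0 * Real.exp (2 * c * t) :=
    mul_exp_le_of_deriv hNd (fun t ht ↦ (le_abs_self _).trans (hNle t ht)) ht
  have hlow (t : ℝ) (ht : t ∈ Icc 0 T) : N 0 * Real.exp (-(2 * c * t)) ≤ N t := by
    have := mul_exp_le_of_deriv (N := fun t ↦ -N t) (c := -(2 * c)) (fun t ht ↦ (hNd t ht).neg)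
      (fun t ht ↦ by
        have h1 := (_root_.abs_le.1 (hNle t ht)).1
        linarith) ht
    simp only [neg_mul] at this
    linarith
  have hct (t : ℝ) (ht : t ∈ Icc 0 T) : c * t ≤ 1 / 32 :=
    (mul_le_mul_of_nonneg_left ht.2 hc.le).trans hT
  -- The exponent 2ct is at most 1/16, so the exponential is below 4; the lower bound 1/4 for its
  -- inverse is equally generous.
  have hup' (t : ℝ) (ht : t ∈ Icc 0 T) : √(N t) ≤ 2 * √(N 0) := by
    rw [show 2 * √(N 0) = √(N 0 * 4) by
      rw [Real.sqrt_mul' _ (by norm_num), show (4 : ℝ) = 2 ^ 2 by norm_num,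
        Real.sqrt_sq (by norm_num), mul_comm]]
    apply Real.sqrt_le_sqrt
    refine (hup t ht).trans (mul_le_mul_of_nonneg_left ?_ (hN0 0 h0T))
    have h1 : Real.exp (2 * c * t) ≤ Real.exp 1 := Real.exp_le_exp.2 (by linarith [hct t ht])
    linarith [Real.exp_one_lt_d9]
  have hlow' (t : ℝ) (ht : t ∈ Icc 0 T) : 1 / 2 * √(N 0) ≤ √(N t) := by
    rw [show 1 / 2 * √(N 0) = √(N 0 * (1 / 4)) by
      rw [Real.sqrt_mul' _ (by norm_num), show (1 / 4 : ℝ) = (1 / 2) ^ 2 by norm_num,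
        Real.sqrt_sq (by norm_num), mul_comm]]
    apply Real.sqrt_le_sqrt
    refine le_trans (mul_le_mul_of_nonneg_left ?_ (hN0 0 h0T)) (hlow t ht)
    have h1 := Real.add_one_le_exp (-(2 * c * t))
    linarith [hct t ht]
  -- By the Gauss lemma ⟨y, A⟩ = g(y, A) ≤ ‖y‖√N, where √N ≤ 2√N(0).
  have hnorm (t : ℝ) (ht : t ∈ Icc 0 T) : ‖y t‖ ≤ 2 * √(N 0) * t := by
    refine norm_le_of_inner_deriv_le h0 (by positivity) hy (fun t ht ↦ ?_) ht
    rw [← h.gauss (hyr t ht)]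
    refine (le_abs_self _).trans ((h.abs_le (hyr t ht) _ _).trans ?_)
    rw [h.apply_self (hyr t ht), real_inner_self_eq_norm_sq, Real.sqrt_sq (norm_nonneg _), mul_comm]
    exact mul_le_mul_of_nonneg_right (hup' t ht) (norm_nonneg _)
  set H : ℝ → ℝ := fun t ↦ inner ℝ (y t) (A (y t)) with hHdef
  set H' : ℝ → ℝ := fun t ↦ inner ℝ (y t) (fderiv ℝ A (y t) (A (y t))) +
    inner ℝ (A (y t)) (A (y t)) with hH'def
  have hHd (t : ℝ) (ht : t ∈ Icc 0 T) : HasDerivAt H (H' t) t := (hy t ht).inner ℝ (hAy t ht)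
  -- H' is the Hessian term plus g(y, D). The first is at least N/2 ≥ √N√N(0)/4, the second at least
  -- −√N√N(0)/16.
  have hH' (t : ℝ) (ht : t ∈ Icc 0 T) : 1 / 16 * √(N t) * √(N 0) ≤ H' t := by
    have h1 := h.half_le_hessian hK hR (hyr t ht) (hyK t ht) (A (y t))
    have h2 := (_root_.abs_le.1 (hDc t ht (y t))).1
    rw [h.apply_self (hyr t ht), real_inner_self_eq_norm_sq, Real.sqrt_sq (norm_nonneg _),
      h.symm _ (hyr t ht), h.gauss (hyr t ht), hDdef, inner_add_right] at h2
    have h3 : N t = √(N t) * √(N t) := (Real.mul_self_sqrt (hN0 t ht)).symm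
    have h4 : c * √(N t) * ‖y t‖ ≤ 1 / 16 * √(N t) * √(N 0) := by
      calc c * √(N t) * ‖y t‖ ≤ c * √(N t) * (2 * √(N 0) * t) := by
            gcongr; exact hnorm t ht
        _ = (c * t) * (2 * √(N t) * √(N 0)) := by ring
        _ ≤ 1 / 32 * (2 * √(N t) * √(N 0)) := by gcongr; exact hct t ht
        _ = _ := by ring
    have h5 : √(N t) * (1 / 2 * √(N 0)) ≤ √(N t) * √(N t) := by gcongr; exact hlow' t ht
    have h6 : 0 ≤ √(N t) * √(N 0) := by positivity
    change _ ≤ inner ℝ (y t) (fderiv ℝ A (y t) (A (y t))) + inner ℝ (A (y t)) (A (y t))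
    change 1 / 2 * N t ≤ _ at h1
    linarith
  have hH0 : H 0 = 0 := by simp [hHdef, h0]
  have hHnn (t : ℝ) (ht : t ∈ Icc 0 T) : 0 ≤ H t := by
    have hm : MonotoneOn H (Icc 0 T) :=
      monotoneOn_of_hasDerivWithinAt_nonneg (convex_Icc 0 T)
        (fun t ht ↦ (hHd t ht).continuousAt.continuousWithinAt)
        (fun t ht ↦ (hHd t (interior_subset ht)).hasDerivWithinAt)
        (fun t ht ↦ le_trans (by positivity) (hH' t (interior_subset ht)))
    rw [← hH0]
    exact hm h0T ht ht.1
  have hsq (t : ℝ) (ht : t ∈ Icc 0 T) : HasDerivAt (fun t ↦ ‖y t‖ ^ 2) (2 * H t) t :=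
    (hy t ht).norm_sq
  constructor
  · have hm : MonotoneOn (fun t ↦ ‖y t‖ ^ 2) (Icc 0 T) :=
      monotoneOn_of_hasDerivWithinAt_nonneg (convex_Icc 0 T)
        (fun t ht ↦ (hsq t ht).continuousAt.continuousWithinAt)
        (fun t ht ↦ (hsq t (interior_subset ht)).hasDerivWithinAt)
        (fun t ht ↦ mul_nonneg zero_le_two (hHnn t (interior_subset ht)))
    intro s hs t ht hst
    exact le_of_sq_le_sq (hm hs ht hst) (norm_nonneg _)
  · intro hA0
    have hNpos : 0 < √(N 0) := by
      apply Real.sqrt_pos.2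
      exact h.pos _ (hyr 0 h0T) _ (by rwa [h0])
    have hHpos (t : ℝ) (ht : t ∈ Ioc 0 T) : 0 < H t := by
      have hm : StrictMonoOn H (Icc 0 T) :=
        strictMonoOn_of_hasDerivWithinAt_pos (convex_Icc 0 T)
          (fun t ht ↦ (hHd t ht).continuousAt.continuousWithinAt)
          (fun t ht ↦ (hHd t (interior_subset ht)).hasDerivWithinAt)
          (fun t ht ↦ by
            have h1 := hlow' t (interior_subset ht)
            have h2 : 0 < √(N t) := lt_of_lt_of_le (by positivity) h1
            exact lt_of_lt_of_le (by positivity) (hH' t (interior_subset ht)))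
      rw [← hH0]
      exact hm h0T (Ioc_subset_Icc_self ht) ht.1
    have hm : StrictMonoOn (fun t ↦ ‖y t‖ ^ 2) (Icc 0 T) :=
      strictMonoOn_of_hasDerivWithinAt_pos (convex_Icc 0 T)
        (fun t ht ↦ (hsq t ht).continuousAt.continuousWithinAt)
        (fun t ht ↦ (hsq t (interior_subset ht)).hasDerivWithinAt)
        (fun t ht ↦ by
          rw [interior_Icc] at ht
          exact mul_pos zero_lt_two (hHpos t ⟨ht.1, ht.2.le⟩))
    intro s hs t ht hst
    exact lt_of_pow_lt_pow_left₀ 2 (norm_nonneg _) (hm hs ht hst)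

end IsNormalMetric

end RadialGrowth

/-! ### Vector fields and integral curves in a chart -/

section ChartCalculus

variable {n : ℕ} {M : Type*} [MetricSpace M] [ChartedSpace (EuclideanSpace ℝ (Fin n)) M]
  [IsManifold (𝓡 n) ∞ M]
  {φ : OpenPartialHomeomorph M (EuclideanSpace ℝ (Fin n))}

lemma mdifferentiable_of_mem_maximalAtlas (hφ : φ ∈ IsManifold.maximalAtlas (𝓡 n) ∞ M) :
    φ.MDifferentiable (𝓡 n) (𝓡 n) :=
  ⟨(contMDiffOn_of_mem_maximalAtlas hφ).mdifferentiableOn (by simp),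
    (contMDiffOn_symm_of_mem_maximalAtlas hφ).mdifferentiableOn (by simp)⟩

/-- The differential of the inverse of a chart. -/
def chartLift (φ : OpenPartialHomeomorph M (EuclideanSpace ℝ (Fin n)))
    (y : EuclideanSpace ℝ (Fin n)) : EuclideanSpace ℝ (Fin n) →L[ℝ] TangentSpace (𝓡 n) (φ.symm y) :=
  mfderiv 𝓘(ℝ, EuclideanSpace ℝ (Fin n)) (𝓡 n) φ.symm y

/-- The expression of a vector field in a chart. -/
def chartField (φ : OpenPartialHomeomorph M (EuclideanSpace ℝ (Fin n)))
    (A : (x : M) → TangentSpace (𝓡 n) x) (y : EuclideanSpace ℝ (Fin n)) :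
    EuclideanSpace ℝ (Fin n) :=
  mfderiv (𝓡 n) 𝓘(ℝ, EuclideanSpace ℝ (Fin n)) φ (φ.symm y) (A (φ.symm y))

lemma vectorComp_eq (A : (x : M) → TangentSpace (𝓡 n) x) (a : Fin n) (b : Fin 0 → Fin n)
    (y : EuclideanSpace ℝ (Fin n)) : vectorComp φ A a b y = chartField φ A y a := rfl

lemma chartLift_chartField (hφ : φ ∈ IsManifold.maximalAtlas (𝓡 n) ∞ M)
    (A : (x : M) → TangentSpace (𝓡 n) x) {y : EuclideanSpace ℝ (Fin n)} (hy : y ∈ φ.target) :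
    chartLift φ y (chartField φ A y) = A (φ.symm y) := by
  have h := (mdifferentiable_of_mem_maximalAtlas hφ).symm_comp_deriv (φ.map_target hy)
  let L : EuclideanSpace ℝ (Fin n) → EuclideanSpace ℝ (Fin n) →L[ℝ] EuclideanSpace ℝ (Fin n) :=
    fun z ↦ mfderiv (𝓡 n) (𝓡 n) φ.symm z
  have h2 : L (φ (φ.symm y)) (chartField φ A y) = A (φ.symm y) :=
    congrArg (fun L ↦ L (A (φ.symm y))) h
  rw [φ.right_inv hy] at h2
  exact h2

lemma chartField_apply (A : (x : M) → TangentSpace (𝓡 n) x) {x : M} (hx : x ∈ φ.source) :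
    chartField φ A (φ x) = mfderiv (𝓡 n) 𝓘(ℝ, EuclideanSpace ℝ (Fin n)) φ x (A x) := by
  let F : M → EuclideanSpace ℝ (Fin n) := fun x ↦
    mfderiv (𝓡 n) 𝓘(ℝ, EuclideanSpace ℝ (Fin n)) φ x (A x)
  have : F (φ.symm (φ x)) = F x := by rw [φ.left_inv hx]
  exact this

lemma chartLift_injective (hφ : φ ∈ IsManifold.maximalAtlas (𝓡 n) ∞ M)
    {y : EuclideanSpace ℝ (Fin n)} (hy : y ∈ φ.target) : Function.Injective (chartLift φ y) :=
  (mdifferentiable_of_mem_maximalAtlas hφ).symm.mfderiv_injective hy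

lemma contMDiffOn_chartLift (hφ : φ ∈ IsManifold.maximalAtlas (𝓡 n) ∞ M)
    (v : EuclideanSpace ℝ (Fin n)) :
    ContMDiffOn 𝓘(ℝ, EuclideanSpace ℝ (Fin n)) (𝓡 n).tangent ∞
      (fun y ↦ (⟨φ.symm y, chartLift φ y v⟩ : TangentBundle (𝓡 n) M)) φ.target := by
  have h1 := (contMDiffOn_symm_of_mem_maximalAtlas hφ).contMDiffOn_tangentMapWithin
    (m := ∞) (by simp) φ.open_target.uniqueMDiffOn
  have h2 : ContMDiffOn 𝓘(ℝ, EuclideanSpace ℝ (Fin n)) (𝓡 n).tangent ∞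
      (fun y ↦ (⟨y, v⟩ : TangentBundle (𝓡 n) (EuclideanSpace ℝ (Fin n)))) φ.target :=
    contMDiffOn_vectorSpace_iff_contDiffOn.2 contDiffOn_const
  refine (h1.comp h2 (fun y hy ↦ hy)).congr fun y hy ↦ ?_
  simp only [Function.comp_apply, tangentMapWithin, chartLift]
  rw [mfderivWithin_of_isOpen φ.open_target hy]
  rfl

lemma contDiffOn_chartField (hφ : φ ∈ IsManifold.maximalAtlas (𝓡 n) ∞ M)
    {A : (x : M) → TangentSpace (𝓡 n) x}
    (hA : ContMDiff (𝓡 n) (𝓡 n).tangent ∞ (fun x ↦ (⟨x, A x⟩ : TangentBundle (𝓡 n) M))) :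
    ContDiffOn ℝ ∞ (chartField φ A) φ.target := by
  have h1 := (contMDiffOn_of_mem_maximalAtlas hφ).contMDiffOn_tangentMapWithin
    (m := ∞) (by simp) φ.open_source.uniqueMDiffOn
  have h2 := h1.comp (hA.comp_contMDiffOn (contMDiffOn_symm_of_mem_maximalAtlas hφ))
    (fun y hy ↦ φ.map_target hy)
  have h3 := (contMDiff_snd_tangentBundle_modelSpace (n := ∞) (EuclideanSpace ℝ (Fin n))
    (𝓡 n)).comp_contMDiffOn h2
  refine (contMDiffOn_iff_contDiffOn.1 h3).congr fun y hy ↦ ?_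
  have h4 : mfderivWithin (𝓡 n) (𝓡 n) φ φ.source (φ.symm y) = mfderiv (𝓡 n) (𝓡 n) φ (φ.symm y) :=
    mfderivWithin_of_isOpen φ.open_source (φ.map_target hy)
  exact (congrArg (fun L ↦ L (A (φ.symm y))) h4).symm

/-- An integral curve solves an ordinary differential equation in a chart. -/
lemma hasDerivAt_chart (hφ : φ ∈ IsManifold.maximalAtlas (𝓡 n) ∞ M)
    {A : (x : M) → TangentSpace (𝓡 n) x} {γ : ℝ → M} {t : ℝ} (ht : γ t ∈ φ.source)
    (hγ : HasMFDerivAt 𝓘(ℝ, ℝ) (𝓡 n) γ t ((1 : ℝ →L[ℝ] ℝ).smulRight (A (γ t)))) :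
    HasDerivAt (fun s ↦ φ (γ s)) (chartField φ A (φ (γ t))) t := by
  have h1 := ((mdifferentiable_of_mem_maximalAtlas hφ).mdifferentiableAt ht).hasMFDerivAt
  let D : EuclideanSpace ℝ (Fin n) →L[ℝ] EuclideanSpace ℝ (Fin n) := mfderiv (𝓡 n) (𝓡 n) φ (γ t)
  let a : EuclideanSpace ℝ (Fin n) := A (γ t)
  have h2 : HasFDerivAt (φ ∘ γ) (D.comp ((1 : ℝ →L[ℝ] ℝ).smulRight a)) t :=
    hasMFDerivAt_iff_hasFDerivAt.1 (HasMFDerivAt.comp t h1 hγ)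
  refine h2.hasDerivAt.congr_deriv ?_
  rw [chartField_apply A ht]
  change D ((1 : ℝ) • a) = D a
  rw [one_smul]

/-- A solution of the ordinary differential equation in a chart is an integral curve. -/
lemma hasMFDerivAt_chart_symm (hφ : φ ∈ IsManifold.maximalAtlas (𝓡 n) ∞ M)
    {A : (x : M) → TangentSpace (𝓡 n) x} {y : ℝ → EuclideanSpace ℝ (Fin n)} {t : ℝ}
    (ht : y t ∈ φ.target) (hy : HasDerivAt y (chartField φ A (y t)) t) :
    HasMFDerivAt 𝓘(ℝ, ℝ) (𝓡 n) (fun s ↦ φ.symm (y s)) t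
      ((1 : ℝ →L[ℝ] ℝ).smulRight (A (φ.symm (y t)))) := by
  have h1 := ((mdifferentiable_of_mem_maximalAtlas hφ).mdifferentiableAt_symm ht).hasMFDerivAt
  have h2 := h1.comp t hy.hasFDerivAt.hasMFDerivAt
  refine h2.congr_mfderiv ?_
  ext
  change chartLift φ (y t) ((1 : ℝ) • chartField φ A (y t)) = (1 : ℝ) • A (φ.symm (y t))
  rw [one_smul, one_smul, chartLift_chartField hφ A ht]

end ChartCalculus

/-! ### The tensor norm dominates contractions -/

section TensorContraction

lemma sum_sum_factored_mul {ι κ : Type*} [Fintype ι] [Fintype κ] {P : ι → ι → ℝ} {B : κ → ι → ℝ}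
    (hP : ∀ a a', P a a' = ∑ k, B k a * B k a') (x : ι → ℝ) :
    ∑ a, ∑ a', P a a' * x a * x a' = ∑ k, (∑ a, B k a * x a) ^ 2 := by
  simp_rw [hP, sq, Finset.sum_mul_sum, Finset.sum_mul]
  symm
  rw [Finset.sum_comm]
  refine Finset.sum_congr rfl fun a _ ↦ ?_
  rw [Finset.sum_comm]
  exact Finset.sum_congr rfl fun a' _ ↦ Finset.sum_congr rfl fun k _ ↦ by ring

/-- Cauchy–Schwarz over multi-indices; the sum of the squared products factorises. -/
lemma sq_sum_mul_prod_le {ι κ : Type*} [Fintype ι] [DecidableEq ι] [Fintype κ] (t : (ι → κ) → ℝ)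
    (v : ι → κ → ℝ) :
    (∑ β, t β * ∏ i, v i (β i)) ^ 2 ≤ (∑ β, t β ^ 2) * ∏ i, ∑ k, v i k ^ 2 := by
  refine (Finset.sum_mul_sq_le_sq_mul_sq _ _ _).trans_eq ?_
  rw [Finset.prod_univ_sum]
  simp [Finset.prod_pow]

open scoped MatrixOrder Matrix.Norms.L2Operator in
lemma exists_eq_transpose_mul_self {n : ℕ} {G : Matrix (Fin n) (Fin n) ℝ} (hG : G.PosSemidef) :
    ∃ C : Matrix (Fin n) (Fin n) ℝ, G = C.transpose * C := by
  obtain ⟨C, hC⟩ := CStarAlgebra.nonneg_iff_eq_star_mul_self.mp hG.nonneg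
  exact ⟨C, by rw [hC, Matrix.star_eq_conjTranspose, Matrix.conjTranspose_eq_transpose_of_trivial]⟩

/-- Writing G = CᵀC amounts to passing to an orthonormal frame: S and V are the components there,
the tensor norm becomes the Euclidean norm of S, and Cauchy–Schwarz applies for each upper index. -/
lemma tensor_contraction_le {n m : ℕ} {G : Matrix (Fin n) (Fin n) ℝ} (hG : G.PosDef)
    (T : Fin n → (Fin m → Fin n) → ℝ) (X : Fin m → Fin n → ℝ) :
    ∑ a, ∑ a', G a a' * (∑ b, T a b * ∏ i, X i (b i)) * (∑ b, T a' b * ∏ i, X i (b i)) ≤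
      (∑ a, ∑ a', ∑ b : Fin m → Fin n, ∑ b' : Fin m → Fin n,
        G a a' * (∏ i, G⁻¹ (b i) (b' i)) * T a b * T a' b') *
        ∏ i, ∑ b, ∑ b', G b b' * X i b * X i b' := by
  obtain ⟨C, hC⟩ := exists_eq_transpose_mul_self hG.posSemidef
  have hCG : ∀ a a', G a a' = ∑ k, C k a * C k a' := fun a a' ↦ by
    rw [hC]; simp [Matrix.mul_apply]
  have hdet : IsUnit C.det := by
    have h1 := hG.det_pos
    rw [hC, Matrix.det_mul] at h1
    exact isUnit_iff_ne_zero.2 fun h0 ↦ by simp [h0] at h1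
  have hDG : ∀ a a', G⁻¹ a a' = ∑ k, C⁻¹ a k * C⁻¹ a' k := fun a a' ↦ by
    rw [hC, Matrix.mul_inv_rev, Matrix.mul_apply]
    simp [← Matrix.transpose_nonsing_inv]
  have hX (i : Fin m) (b : Fin n) : X i b = ∑ k, C⁻¹ b k * ∑ c, C k c * X i c := by
    have h1 : (C⁻¹ * C).mulVec (X i) b = X i b := by
      rw [Matrix.nonsing_inv_mul _ hdet, Matrix.one_mulVec]
    rw [← h1, ← Matrix.mulVec_mulVec]
    rfl
  set V : Fin m → Fin n → ℝ := fun i k ↦ ∑ c, C k c * X i c with hV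
  set S : Fin n → (Fin m → Fin n) → ℝ := fun α β ↦ ∑ a, ∑ b, C α a * (∏ i, C⁻¹ (b i) (β i)) * T a b
    with hS
  have h1 : ∀ i, ∑ b, ∑ b', G b b' * X i b * X i b' = ∑ k, V i k ^ 2 := fun i ↦
    sum_sum_factored_mul hCG (X i)
  have h2 : ∑ a, ∑ a', G a a' * (∑ b, T a b * ∏ i, X i (b i)) * (∑ b, T a' b * ∏ i, X i (b i)) =
      ∑ α, (∑ β, S α β * ∏ i, V i (β i)) ^ 2 := by
    rw [sum_sum_factored_mul hCG]
    refine Finset.sum_congr rfl fun α _ ↦ ?_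
    congr 1
    have h3 (b : Fin m → Fin n) : ∏ i, X i (b i) = ∑ β : Fin m → Fin n,
        (∏ i, C⁻¹ (b i) (β i)) * ∏ i, V i (β i) := by
      simp_rw [← Finset.prod_mul_distrib]
      rw [Finset.prod_congr rfl fun i _ ↦ hX i (b i), Finset.prod_univ_sum]
      simp [hV]
    simp_rw [h3, hS, Finset.sum_mul, Finset.mul_sum]
    symm
    rw [Finset.sum_comm]
    refine Finset.sum_congr rfl fun a _ ↦ ?_
    rw [Finset.sum_comm]
    exact Finset.sum_congr rfl fun b _ ↦ Finset.sum_congr rfl fun β _ ↦ by ring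
  have h4 : ∑ a, ∑ a', ∑ b : Fin m → Fin n, ∑ b' : Fin m → Fin n,
      G a a' * (∏ i, G⁻¹ (b i) (b' i)) * T a b * T a' b' = ∑ α, ∑ β, S α β ^ 2 := by
    -- The quadratic form on all indices at once is G ⊗ (G⁻¹)^⊗m, with square factor C tensored with
    -- copies of the transpose of C⁻¹.
    have h5 := sum_sum_factored_mul (ι := Fin n × (Fin m → Fin n)) (κ := Fin n × (Fin m → Fin n))
      (P := fun p q ↦ G p.1 q.1 * ∏ i, G⁻¹ (p.2 i) (q.2 i))
      (B := fun k p ↦ C k.1 p.1 * ∏ i, C⁻¹ (p.2 i) (k.2 i)) (fun p q ↦ by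
        simp_rw [hDG, hCG, Finset.prod_univ_sum, Fintype.piFinset_univ, Fintype.sum_prod_type,
          Finset.sum_mul_sum, Finset.prod_mul_distrib]
        exact Finset.sum_congr rfl fun a _ ↦ Finset.sum_congr rfl fun b _ ↦ by ring)
      (fun p ↦ T p.1 p.2)
    simp only [Fintype.sum_prod_type] at h5
    rw [← h5]
    refine Finset.sum_congr rfl fun a _ ↦ ?_
    rw [Finset.sum_comm]
  rw [h2, h4, Finset.prod_congr rfl fun i _ ↦ h1 i, Finset.sum_mul]
  exact Finset.sum_le_sum fun α _ ↦ sq_sum_mul_prod_le _ _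

end TensorContraction

/-! ### Partial derivatives of functions on ℝⁿ -/

section PartialDerivatives

variable {n : ℕ}

lemma fderiv_eq_sum_partialD (f : EuclideanSpace ℝ (Fin n) → ℝ) (y w : EuclideanSpace ℝ (Fin n)) :
    fderiv ℝ f y w = ∑ c, w c * partialD c f y := by
  conv_lhs => rw [← (EuclideanSpace.basisFun (Fin n) ℝ).sum_repr w]
  simp [partialD]

lemma contDiffOn_partialD {f : EuclideanSpace ℝ (Fin n) → ℝ} {s : Set (EuclideanSpace ℝ (Fin n))}
    (hs : IsOpen s) (hf : ContDiffOn ℝ ∞ f s) (c : Fin n) : ContDiffOn ℝ ∞ (partialD c f) s :=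
  (hf.fderiv_of_isOpen hs (by simp)).clm_apply contDiffOn_const

lemma contDiffOn_smul_const {E F : Type*} [NormedAddCommGroup E] [NormedSpace ℝ E]
    [NormedAddCommGroup F] [NormedSpace ℝ F] {f : E → ℝ} {s : Set E} (hf : ContDiffOn ℝ ∞ f s)
    (L : F) : ContDiffOn ℝ ∞ (fun y ↦ f y • L) s :=
  hf.smul contDiffOn_const

end PartialDerivatives

/-! ### Metric and connection in a chart as bilinear maps -/

section ChartMetric

variable {n : ℕ} {M : Type*} [MetricSpace M] [ChartedSpace (EuclideanSpace ℝ (Fin n)) M]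
  [IsManifold (𝓡 n) ∞ M] [RiemannianBundle (fun x : M ↦ TangentSpace (𝓡 n) x)]
  {φ : OpenPartialHomeomorph M (EuclideanSpace ℝ (Fin n))}

lemma metricMatrix_apply (y : EuclideanSpace ℝ (Fin n)) (a b : Fin n) :
    metricMatrix φ y a b = inner ℝ (chartLift φ y (EuclideanSpace.single a 1))
      (chartLift φ y (EuclideanSpace.single b 1)) := rfl

/-- The metric in a chart, as a bilinear form. -/
def chartMetric (φ : OpenPartialHomeomorph M (EuclideanSpace ℝ (Fin n)))
    (y : EuclideanSpace ℝ (Fin n)) :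
    EuclideanSpace ℝ (Fin n) →L[ℝ] EuclideanSpace ℝ (Fin n) →L[ℝ] ℝ :=
  ∑ a, ∑ b, metricMatrix φ y a b • (EuclideanSpace.proj a : EuclideanSpace ℝ (Fin n) →L[ℝ] ℝ).smulRight
    (EuclideanSpace.proj b : EuclideanSpace ℝ (Fin n) →L[ℝ] ℝ)

/-- The Levi-Civita connection in a chart, as a bilinear map. -/
def chartConnection (φ : OpenPartialHomeomorph M (EuclideanSpace ℝ (Fin n)))
    (y : EuclideanSpace ℝ (Fin n)) :
    EuclideanSpace ℝ (Fin n) →L[ℝ] EuclideanSpace ℝ (Fin n) →L[ℝ] EuclideanSpace ℝ (Fin n) :=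
  ∑ a, ∑ b, ∑ c, christoffel φ a b c y •
    (EuclideanSpace.proj b : EuclideanSpace ℝ (Fin n) →L[ℝ] ℝ).smulRight
      ((EuclideanSpace.proj c : EuclideanSpace ℝ (Fin n) →L[ℝ] ℝ).smulRight
        (EuclideanSpace.single a (1 : ℝ)))

lemma chartMetric_apply (y u v : EuclideanSpace ℝ (Fin n)) :
    chartMetric φ y u v = ∑ a, ∑ b, metricMatrix φ y a b * (u a * v b) := by
  simp [chartMetric]

lemma chartConnection_apply (y u v : EuclideanSpace ℝ (Fin n)) (a : Fin n) :
    chartConnection φ y u v a = ∑ b, ∑ c, christoffel φ a b c y * (u b * v c) := by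
  simp [chartConnection, Finset.sum_apply, Pi.single_apply]

lemma chartMetric_eq_inner (y u v : EuclideanSpace ℝ (Fin n)) :
    chartMetric φ y u v = inner ℝ (chartLift φ y u) (chartLift φ y v) := by
  have h (w : EuclideanSpace ℝ (Fin n)) :
      chartLift φ y w = ∑ a, w a • chartLift φ y (EuclideanSpace.single a 1) := by
    conv_lhs => rw [← (EuclideanSpace.basisFun (Fin n) ℝ).sum_repr w]
    simp
  rw [chartMetric_apply, h u, h v, sum_inner]
  refine Finset.sum_congr rfl fun a _ ↦ ?_
  rw [inner_sum]
  refine Finset.sum_congr rfl fun b _ ↦ ?_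
  rw [inner_smul_left, inner_smul_right, metricMatrix_apply]
  simp only [conj_trivial]
  ring

lemma chartMetric_symm (y u v : EuclideanSpace ℝ (Fin n)) :
    chartMetric φ y u v = chartMetric φ y v u := by
  rw [chartMetric_eq_inner, chartMetric_eq_inner, real_inner_comm]

lemma metricMatrix_symm (y : EuclideanSpace ℝ (Fin n)) (a b : Fin n) :
    metricMatrix φ y a b = metricMatrix φ y b a := by
  rw [metricMatrix_apply, metricMatrix_apply, real_inner_comm]

lemma christoffel_symm (y : EuclideanSpace ℝ (Fin n)) (a b c : Fin n) :
    christoffel φ a b c y = christoffel φ a c b y := by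
  unfold christoffel
  congr 1
  refine Finset.sum_congr rfl fun d _ ↦ ?_
  simp_rw [metricMatrix_symm _ d, metricMatrix_symm _ c b]
  ring

lemma chartConnection_symm (y u v : EuclideanSpace ℝ (Fin n)) :
    chartConnection φ y u v = chartConnection φ y v u := by
  ext a
  rw [chartConnection_apply, chartConnection_apply, Finset.sum_comm]
  refine Finset.sum_congr rfl fun b _ ↦ Finset.sum_congr rfl fun c _ ↦ ?_
  rw [christoffel_symm, mul_comm (u c)]

lemma chartMetric_pos (hφ : φ ∈ IsManifold.maximalAtlas (𝓡 n) ∞ M)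
    {y : EuclideanSpace ℝ (Fin n)} (hy : y ∈ φ.target) {v : EuclideanSpace ℝ (Fin n)}
    (hv : v ≠ 0) : 0 < chartMetric φ y v v := by
  rw [chartMetric_eq_inner]
  exact real_inner_self_pos.2 fun h0 ↦ hv (chartLift_injective hφ hy (by rw [h0, map_zero]))

lemma posDef_metricMatrix (hφ : φ ∈ IsManifold.maximalAtlas (𝓡 n) ∞ M)
    {y : EuclideanSpace ℝ (Fin n)} (hy : y ∈ φ.target) : (metricMatrix φ y).PosDef := by
  rw [Matrix.posDef_iff_dotProduct_mulVec]
  refine ⟨Matrix.IsHermitian.ext fun a b ↦ metricMatrix_symm _ _ _, fun x hx ↦ ?_⟩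
  have h := chartMetric_pos hφ hy (v := WithLp.toLp 2 x) (by simpa using hx)
  rw [chartMetric_apply] at h
  simp only [dotProduct, Matrix.mulVec, star_trivial, Finset.mul_sum] at h ⊢
  refine h.trans_eq (Finset.sum_congr rfl fun a _ ↦ Finset.sum_congr rfl fun b _ ↦ ?_)
  ring

variable [IsContMDiffRiemannianBundle (𝓡 n) ∞ (EuclideanSpace ℝ (Fin n))
  (fun x : M ↦ TangentSpace (𝓡 n) x)]

lemma contDiffOn_metricMatrix (hφ : φ ∈ IsManifold.maximalAtlas (𝓡 n) ∞ M) (a b : Fin n) :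
    ContDiffOn ℝ ∞ (fun y ↦ metricMatrix φ y a b) φ.target :=
  contMDiffOn_iff_contDiffOn.1
    ((contMDiffOn_chartLift hφ (EuclideanSpace.single a 1)).inner_bundle
      (contMDiffOn_chartLift hφ (EuclideanSpace.single b 1)))

lemma contDiffOn_det {E ι : Type*} [NormedAddCommGroup E] [NormedSpace ℝ E] [Fintype ι]
    [DecidableEq ι] {P : E → Matrix ι ι ℝ} {s : Set E}
    (hP : ∀ i j, ContDiffOn ℝ ∞ (fun y ↦ P y i j) s) : ContDiffOn ℝ ∞ (fun y ↦ (P y).det) s := by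
  simp_rw [Matrix.det_apply]
  exact ContDiffOn.sum fun σ _ ↦ (contDiffOn_prod fun i _ ↦ hP _ _).const_smul _

/-- By Cramer's rule the entries are polynomials in those of the metric, divided by a determinant
that positivity keeps away from zero. -/
lemma contDiffOn_metricMatrix_inv (hφ : φ ∈ IsManifold.maximalAtlas (𝓡 n) ∞ M) (a b : Fin n) :
    ContDiffOn ℝ ∞ (fun y ↦ (metricMatrix φ y)⁻¹ a b) φ.target := by
  simp_rw [Matrix.inv_def, Matrix.smul_apply, Ring.inverse_eq_inv', smul_eq_mul,
    Matrix.adjugate_apply]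
  refine ((contDiffOn_det (contDiffOn_metricMatrix hφ)).inv fun y hy ↦
    (posDef_metricMatrix hφ hy).det_pos.ne').mul (contDiffOn_det fun i j ↦ ?_)
  rcases eq_or_ne i b with rfl | h
  · simpa using contDiffOn_const
  · simpa [Matrix.updateRow_ne h] using contDiffOn_metricMatrix hφ i j

lemma contDiffOn_christoffel (hφ : φ ∈ IsManifold.maximalAtlas (𝓡 n) ∞ M) (a b c : Fin n) :
    ContDiffOn ℝ ∞ (christoffel φ a b c) φ.target := by
  have h (a b c : Fin n) := contDiffOn_partialD φ.open_target (contDiffOn_metricMatrix hφ a b) c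
  exact contDiffOn_const.mul (ContDiffOn.sum fun d _ ↦
    (contDiffOn_metricMatrix_inv hφ a d).mul (((h b d c).add (h d c b)).sub (h b c d)))

lemma contDiffOn_chartMetric (hφ : φ ∈ IsManifold.maximalAtlas (𝓡 n) ∞ M) :
    ContDiffOn ℝ ∞ (chartMetric φ) φ.target :=
  ContDiffOn.sum fun a _ ↦ ContDiffOn.sum fun b _ ↦
    contDiffOn_smul_const (F := EuclideanSpace ℝ (Fin n) →L[ℝ] EuclideanSpace ℝ (Fin n) →L[ℝ] ℝ)
      (contDiffOn_metricMatrix hφ a b) _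

lemma contDiffOn_chartConnection (hφ : φ ∈ IsManifold.maximalAtlas (𝓡 n) ∞ M) :
    ContDiffOn ℝ ∞ (chartConnection φ) φ.target :=
  ContDiffOn.sum fun a _ ↦ ContDiffOn.sum fun b _ ↦ ContDiffOn.sum fun c _ ↦
    contDiffOn_smul_const (F := EuclideanSpace ℝ (Fin n) →L[ℝ]
      EuclideanSpace ℝ (Fin n) →L[ℝ] EuclideanSpace ℝ (Fin n))
      (contDiffOn_christoffel hφ a b c) _

end ChartMetric

/-! ### Koszul formula, covariant derivative and curvature in a chart -/

section ChartIdentities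

variable {n : ℕ} {M : Type*} [MetricSpace M] [ChartedSpace (EuclideanSpace ℝ (Fin n)) M]
  [IsManifold (𝓡 n) ∞ M] [RiemannianBundle (fun x : M ↦ TangentSpace (𝓡 n) x)]
  {φ : OpenPartialHomeomorph M (EuclideanSpace ℝ (Fin n))}

/-- Lowering the upper index cancels the inverse metric, leaving the Christoffel symbols of the
first kind. -/
lemma sum_metricMatrix_mul_christoffel (hφ : φ ∈ IsManifold.maximalAtlas (𝓡 n) ∞ M)
    {y : EuclideanSpace ℝ (Fin n)} (hy : y ∈ φ.target) (b c d : Fin n) :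
    ∑ a, metricMatrix φ y a d * christoffel φ a b c y =
      (1 / 2 : ℝ) * (partialD c (fun z ↦ metricMatrix φ z b d) y
        + partialD b (fun z ↦ metricMatrix φ z d c) y
        - partialD d (fun z ↦ metricMatrix φ z b c) y) := by
  set F : Fin n → ℝ := fun d ↦ partialD c (fun z ↦ metricMatrix φ z b d) y
        + partialD b (fun z ↦ metricMatrix φ z d c) y
        - partialD d (fun z ↦ metricMatrix φ z b c) y with hF
  have h1 : (metricMatrix φ y).mulVec ((metricMatrix φ y)⁻¹.mulVec F) d = F d := by
    rw [Matrix.mulVec_mulVec, Matrix.mul_nonsing_inv _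
      (isUnit_iff_ne_zero.2 (posDef_metricMatrix hφ hy).det_pos.ne'), Matrix.one_mulVec]
  change _ = 1 / 2 * F d
  rw [← h1]
  simp only [Matrix.mulVec, dotProduct, Finset.mul_sum, christoffel]
  refine Finset.sum_congr rfl fun a _ ↦ Finset.sum_congr rfl fun e _ ↦ ?_
  rw [metricMatrix_symm y d a]
  ring

variable [IsContMDiffRiemannianBundle (𝓡 n) ∞ (EuclideanSpace ℝ (Fin n))
  (fun x : M ↦ TangentSpace (𝓡 n) x)]

lemma differentiableAt_chartMetric (hφ : φ ∈ IsManifold.maximalAtlas (𝓡 n) ∞ M)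
    {y : EuclideanSpace ℝ (Fin n)} (hy : y ∈ φ.target) : DifferentiableAt ℝ (chartMetric φ) y :=
  ((contDiffOn_chartMetric hφ).contDiffAt (φ.open_target.mem_nhds hy)).differentiableAt (by simp)

lemma differentiableAt_chartConnection (hφ : φ ∈ IsManifold.maximalAtlas (𝓡 n) ∞ M)
    {y : EuclideanSpace ℝ (Fin n)} (hy : y ∈ φ.target) :
    DifferentiableAt ℝ (chartConnection φ) y :=
  ((contDiffOn_chartConnection hφ).contDiffAt (φ.open_target.mem_nhds hy)).differentiableAt
    (by simp)

lemma fderiv_sum_sum_mul {f : Fin n → Fin n → EuclideanSpace ℝ (Fin n) → ℝ}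
    {y : EuclideanSpace ℝ (Fin n)} (hf : ∀ a b, DifferentiableAt ℝ (f a b) y)
    (k : Fin n → Fin n → ℝ) (w : EuclideanSpace ℝ (Fin n)) :
    fderiv ℝ (fun z ↦ ∑ a, ∑ b, f a b z * k a b) y w =
      ∑ a, ∑ b, (∑ c, w c * partialD c (f a b) y) * k a b := by
  have h : HasFDerivAt (fun z ↦ ∑ a, ∑ b, f a b z * k a b)
      (∑ a, ∑ b, k a b • fderiv ℝ (f a b) y) y :=
    HasFDerivAt.fun_sum fun a _ ↦ HasFDerivAt.fun_sum fun b _ ↦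
      (hf a b).hasFDerivAt.mul_const (k a b)
  rw [h.fderiv]
  simp [fderiv_eq_sum_partialD, mul_comm]

lemma fderiv_chartMetric (hφ : φ ∈ IsManifold.maximalAtlas (𝓡 n) ∞ M)
    {y : EuclideanSpace ℝ (Fin n)} (hy : y ∈ φ.target) (w u v : EuclideanSpace ℝ (Fin n)) :
    fderiv ℝ (chartMetric φ) y w u v =
      ∑ a, ∑ b, (∑ c, w c * partialD c (fun z ↦ metricMatrix φ z a b) y) * (u a * v b) := by
  rw [fderiv_bilin_apply (differentiableAt_chartMetric hφ hy)]
  simp_rw [chartMetric_apply]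
  exact fderiv_sum_sum_mul (fun a b ↦ ((contDiffOn_metricMatrix hφ a b).contDiffAt
    (φ.open_target.mem_nhds hy)).differentiableAt (by simp)) (fun a b ↦ u a * v b) w

lemma fderiv_chartConnection (hφ : φ ∈ IsManifold.maximalAtlas (𝓡 n) ∞ M)
    {y : EuclideanSpace ℝ (Fin n)} (hy : y ∈ φ.target) (w u v : EuclideanSpace ℝ (Fin n))
    (a : Fin n) :
    fderiv ℝ (chartConnection φ) y w u v a =
      ∑ b, ∑ c, (∑ d, w d * partialD d (christoffel φ a b c) y) * (u b * v c) := by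
  rw [fderiv_bilin_apply (differentiableAt_chartConnection hφ hy)]
  have hd : DifferentiableAt ℝ (fun z ↦ chartConnection φ z u v) y :=
    ((differentiableAt_chartConnection hφ hy).clm_apply (differentiableAt_const u)).clm_apply
      (differentiableAt_const v)
  have h1 := ((EuclideanSpace.proj a : EuclideanSpace ℝ (Fin n) →L[ℝ] ℝ).hasFDerivAt.comp y
    hd.hasFDerivAt).fderiv
  have h2 := congrArg (fun L ↦ L w) h1
  change _ = fderiv ℝ (fun z ↦ chartConnection φ z u v) y w a at h2
  rw [← h2, ← fderiv_sum_sum_mul (fun b c ↦ ((contDiffOn_christoffel hφ a b c).contDiffAt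
    (φ.open_target.mem_nhds hy)).differentiableAt (by simp)) (fun b c ↦ u b * v c) w]
  simp_rw [← chartConnection_apply]
  rfl

lemma sum_sum_sum_rotate {ι : Type*} [Fintype ι] (f : ι → ι → ι → ℝ) :
    ∑ a, ∑ b, ∑ c, f a b c = ∑ b, ∑ c, ∑ a, f a b c := by
  rw [Finset.sum_comm]
  exact Finset.sum_congr rfl fun b _ ↦ Finset.sum_comm

/-- The Koszul formula in a chart. -/
lemma chart_koszul (hφ : φ ∈ IsManifold.maximalAtlas (𝓡 n) ∞ M)
    {y : EuclideanSpace ℝ (Fin n)} (hy : y ∈ φ.target) (u v w : EuclideanSpace ℝ (Fin n)) :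
    2 * chartMetric φ y (chartConnection φ y u v) w = fderiv ℝ (chartMetric φ) y v u w
      + fderiv ℝ (chartMetric φ) y u w v - fderiv ℝ (chartMetric φ) y w u v := by
  set p : Fin n → Fin n → Fin n → ℝ := fun c a b ↦ partialD c (fun z ↦ metricMatrix φ z a b) y
    with hp
  have h0 : 2 * chartMetric φ y (chartConnection φ y u v) w =
      ∑ b, ∑ c, ∑ d, (p c b d + p b d c - p d b c) * (u b * v c * w d) := by
    have h1 : chartMetric φ y (chartConnection φ y u v) w =
        ∑ d, ∑ b, ∑ c, (∑ a, metricMatrix φ y a d * christoffel φ a b c y) * (u b * v c * w d) := by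
      rw [chartMetric_apply, Finset.sum_comm]
      refine Finset.sum_congr rfl fun d _ ↦ ?_
      simp_rw [chartConnection_apply, Finset.sum_mul, Finset.mul_sum]
      rw [sum_sum_sum_rotate]
      exact Finset.sum_congr rfl fun b _ ↦ Finset.sum_congr rfl fun c _ ↦
        Finset.sum_congr rfl fun a _ ↦ by ring
    rw [h1, sum_sum_sum_rotate, Finset.mul_sum]
    refine Finset.sum_congr rfl fun b _ ↦ ?_
    rw [Finset.mul_sum]
    refine Finset.sum_congr rfl fun c _ ↦ ?_
    rw [Finset.mul_sum]
    refine Finset.sum_congr rfl fun d _ ↦ ?_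
    rw [sum_metricMatrix_mul_christoffel hφ hy]
    ring
  have h1 : fderiv ℝ (chartMetric φ) y v u w = ∑ b, ∑ c, ∑ d, p c b d * (u b * v c * w d) := by
    rw [fderiv_chartMetric hφ hy]
    refine Finset.sum_congr rfl fun b _ ↦ ?_
    rw [Finset.sum_comm]
    refine Finset.sum_congr rfl fun d _ ↦ ?_
    rw [Finset.sum_mul]
    exact Finset.sum_congr rfl fun c _ ↦ by ring
  have h2 : fderiv ℝ (chartMetric φ) y u w v = ∑ b, ∑ c, ∑ d, p b d c * (u b * v c * w d) := by
    rw [fderiv_chartMetric hφ hy]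
    simp_rw [Finset.sum_mul]
    rw [sum_sum_sum_rotate, Finset.sum_comm]
    exact Finset.sum_congr rfl fun b _ ↦ Finset.sum_congr rfl fun c _ ↦
      Finset.sum_congr rfl fun d _ ↦ by ring
  have h3 : fderiv ℝ (chartMetric φ) y w u v = ∑ b, ∑ c, ∑ d, p d b c * (u b * v c * w d) := by
    rw [fderiv_chartMetric hφ hy]
    simp_rw [Finset.sum_mul]
    exact Finset.sum_congr rfl fun b _ ↦ Finset.sum_congr rfl fun c _ ↦
      Finset.sum_congr rfl fun d _ ↦ by ring
  rw [h0, h1, h2, h3]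
  simp only [← Finset.sum_add_distrib, ← Finset.sum_sub_distrib, add_mul, sub_mul]

/-- The pointwise norm of a tensor field bounds its values. -/
lemma chartMetric_contraction_le (hφ : φ ∈ IsManifold.maximalAtlas (𝓡 n) ∞ M)
    {y : EuclideanSpace ℝ (Fin n)} (hy : y ∈ φ.target) {m : ℕ} (T : TensorComp n m)
    (X : Fin m → EuclideanSpace ℝ (Fin n)) {τ : EuclideanSpace ℝ (Fin n)}
    (hτ : ∀ a, τ a = ∑ b, T a b y * ∏ i, X i (b i)) :
    √(chartMetric φ y τ τ) ≤ tensorNorm φ T y * ∏ i, √(chartMetric φ y (X i) (X i)) := by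
  have hnn (v : EuclideanSpace ℝ (Fin n)) : 0 ≤ chartMetric φ y v v := by
    rw [chartMetric_eq_inner]
    exact real_inner_self_nonneg
  have h := tensor_contraction_le (posDef_metricMatrix hφ hy) (fun a b ↦ T a b y)
    (fun i b ↦ X i b)
  simp_rw [← hτ, mul_assoc (metricMatrix φ y _ _), ← chartMetric_apply] at h
  have h2 := Real.sqrt_le_sqrt h
  have h3 : √(∏ i, chartMetric φ y (X i) (X i)) = ∏ i, √(chartMetric φ y (X i) (X i)) :=
    Real.sqrt_prod _ fun i _ ↦ hnn _
  rw [Real.sqrt_mul' _ (Finset.prod_nonneg fun i _ ↦ hnn _), h3] at h2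
  refine h2.trans_eq ?_
  simp only [tensorNorm, mul_assoc]

/-- Identifies the invariant expression for ∇_v A with the component definition, so that the tensor
norm controls it. -/
lemma covDeriv_contraction {y : EuclideanSpace ℝ (Fin n)} {A : (x : M) → TangentSpace (𝓡 n) x}
    (hA : DifferentiableAt ℝ (chartField φ A) y) (v : EuclideanSpace ℝ (Fin n)) (a : Fin n) :
    (fderiv ℝ (chartField φ A) y v + chartConnection φ y v (chartField φ A y)) a =
      ∑ b : Fin 1 → Fin n, covDeriv φ (vectorComp φ A) a b y * ∏ _i : Fin 1, v (b _i) := by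
  have h1 : fderiv ℝ (chartField φ A) y v a = fderiv ℝ (fun z ↦ chartField φ A z a) y v := by
    have h1 := ((EuclideanSpace.proj a : EuclideanSpace ℝ (Fin n) →L[ℝ] ℝ).hasFDerivAt.comp y
      hA.hasFDerivAt).fderiv
    exact (congrArg (fun L ↦ L v) h1).symm
  rw [← (Equiv.funUnique (Fin 1) (Fin n)).symm.sum_comp]
  rw [PiLp.add_apply, h1, fderiv_eq_sum_partialD, chartConnection_apply, ← Finset.sum_add_distrib]
  refine Finset.sum_congr rfl fun b _ ↦ ?_
  simp only [covDeriv, Finset.univ_unique, Finset.prod_singleton, Finset.univ_eq_empty,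
    Finset.sum_empty, sub_zero, add_mul, Finset.sum_mul]
  congr 1
  · exact mul_comm _ _
  · exact Finset.sum_congr rfl fun s _ ↦ by
      simp only [Equiv.funUnique_symm_apply, uniqueElim_const, vectorComp_eq]
      ring

lemma sum_fin_succ_fun {m : ℕ} (f : (Fin (m + 1) → Fin n) → ℝ) :
    ∑ b, f b = ∑ i, ∑ b, f (Fin.cons i b) := by
  rw [← (Fin.consEquiv fun _ ↦ Fin n).sum_comp, Fintype.sum_prod_type]
  rfl

/-- Matches the index conventions: the lower indices are, in order, the argument u and the two
directions v, w of R(v, w)u. -/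
lemma riemannComp_contraction (hφ : φ ∈ IsManifold.maximalAtlas (𝓡 n) ∞ M)
    {y : EuclideanSpace ℝ (Fin n)} (hy : y ∈ φ.target) (u v w : EuclideanSpace ℝ (Fin n))
    (a : Fin n) :
    connectionCurvature (chartConnection φ) y u v w a =
      ∑ b : Fin 3 → Fin n, riemannComp φ a b y * ∏ i, (![u, v, w] : Fin 3 → _) i (b i) := by
  have h0 : ∑ b : Fin 3 → Fin n, riemannComp φ a b y * ∏ i, (![u, v, w] : Fin 3 → _) i (b i) =
      ∑ c, ∑ d, ∑ e, (partialD d (christoffel φ a e c) y - partialD e (christoffel φ a d c) y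
        + ∑ s, (christoffel φ a d s y * christoffel φ s e c y
          - christoffel φ a e s y * christoffel φ s d c y)) * (u c * v d * w e) := by
    simp_rw [sum_fin_succ_fun]
    refine Finset.sum_congr rfl fun c _ ↦ Finset.sum_congr rfl fun d _ ↦
      Finset.sum_congr rfl fun e _ ↦ ?_
    rw [Fintype.sum_unique, Fin.prod_univ_three]
    rfl
  have h1 : fderiv ℝ (chartConnection φ) y v w u a =
      ∑ c, ∑ d, ∑ e, partialD d (christoffel φ a e c) y * (u c * v d * w e) := by
    rw [fderiv_chartConnection hφ hy]
    simp_rw [Finset.sum_mul]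
    rw [sum_sum_sum_rotate]
    refine Finset.sum_congr rfl fun c _ ↦ Finset.sum_congr rfl fun d _ ↦
      Finset.sum_congr rfl fun e _ ↦ by ring
  have h2 : fderiv ℝ (chartConnection φ) y w v u a =
      ∑ c, ∑ d, ∑ e, partialD e (christoffel φ a d c) y * (u c * v d * w e) := by
    rw [fderiv_chartConnection hφ hy]
    simp_rw [Finset.sum_mul]
    rw [Finset.sum_comm]
    refine Finset.sum_congr rfl fun c _ ↦ Finset.sum_congr rfl fun d _ ↦
      Finset.sum_congr rfl fun e _ ↦ by ring
  have h3 (v w : EuclideanSpace ℝ (Fin n)) :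
      chartConnection φ y v (chartConnection φ y w u) a =
        ∑ d, ∑ e, ∑ c, (∑ s, christoffel φ a d s y * christoffel φ s e c y) * (v d * w e * u c) := by
    rw [chartConnection_apply]
    refine Finset.sum_congr rfl fun d _ ↦ ?_
    simp_rw [chartConnection_apply, Finset.mul_sum, Finset.sum_mul]
    rw [sum_sum_sum_rotate]
    refine Finset.sum_congr rfl fun c _ ↦ Finset.sum_congr rfl fun d _ ↦
      Finset.sum_congr rfl fun e _ ↦ by ring
  have h4 : chartConnection φ y v (chartConnection φ y w u) a =
      ∑ c, ∑ d, ∑ e, (∑ s, christoffel φ a d s y * christoffel φ s e c y) * (u c * v d * w e) := by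
    rw [h3, sum_sum_sum_rotate, sum_sum_sum_rotate]
    refine Finset.sum_congr rfl fun c _ ↦ Finset.sum_congr rfl fun d _ ↦
      Finset.sum_congr rfl fun e _ ↦ by ring
  have h5 : chartConnection φ y w (chartConnection φ y v u) a =
      ∑ c, ∑ d, ∑ e, (∑ s, christoffel φ a e s y * christoffel φ s d c y) * (u c * v d * w e) := by
    rw [h3, sum_sum_sum_rotate, sum_sum_sum_rotate]
    refine Finset.sum_congr rfl fun c _ ↦ ?_
    rw [Finset.sum_comm]
    refine Finset.sum_congr rfl fun d _ ↦ Finset.sum_congr rfl fun e _ ↦ by ring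
  simp only [connectionCurvature, PiLp.sub_apply, PiLp.add_apply]
  rw [h0, h1, h2, h4, h5]
  simp only [← Finset.sum_add_distrib, ← Finset.sum_sub_distrib]
  refine Finset.sum_congr rfl fun c _ ↦ Finset.sum_congr rfl fun d _ ↦
    Finset.sum_congr rfl fun e _ ↦ ?_
  rw [Finset.sum_sub_distrib]
  ring

end ChartIdentities

/-! ### Rescaling and uniqueness of geodesics -/

section Geodesics

variable {n : ℕ} {M : Type*} [MetricSpace M] [ChartedSpace (EuclideanSpace ℝ (Fin n)) M]
  [IsManifold (𝓡 n) ∞ M]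
  {φ : OpenPartialHomeomorph M (EuclideanSpace ℝ (Fin n))}

lemma contDiffAt_chart_comp (hφ : φ ∈ IsManifold.maximalAtlas (𝓡 n) ∞ M) {σ : ℝ → M} {s : Set ℝ}
    (hs : IsOpen s) (hσ : ContMDiffOn 𝓘(ℝ, ℝ) (𝓡 n) ∞ σ s) {t : ℝ} (ht : t ∈ s)
    (hσt : σ t ∈ φ.source) : ContDiffAt ℝ ∞ (fun u ↦ φ (σ u)) t :=
  contMDiffAt_iff_contDiffAt.1
    ((contMDiffAt_of_mem_maximalAtlas hφ hσt).comp t (hσ.contMDiffAt (hs.mem_nhds ht)))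

lemma contDiffAt_comp_fst {E F G : Type*} [NormedAddCommGroup E] [NormedSpace ℝ E]
    [NormedAddCommGroup F] [NormedSpace ℝ F] [NormedAddCommGroup G] [NormedSpace ℝ G]
    {f : E → G} {m : WithTop ℕ∞} {z : E × F} (hf : ContDiffAt ℝ m f z.1) :
    ContDiffAt ℝ m (fun z : E × F ↦ f z.1) z :=
  hf.comp z contDiffAt_fst

lemma hasDerivAt_coord {y : ℝ → EuclideanSpace ℝ (Fin n)} {y' : EuclideanSpace ℝ (Fin n)} {t : ℝ}
    (h : HasDerivAt y y' t) (a : Fin n) : HasDerivAt (fun u ↦ y u a) (y' a) t :=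
  (EuclideanSpace.proj a : EuclideanSpace ℝ (Fin n) →L[ℝ] ℝ).hasFDerivAt.comp_hasDerivAt t h

/-- The coordinates of the initial velocity of a curve. -/
lemma hasDerivAt_chart_of_eq (hφ : φ ∈ IsManifold.maximalAtlas (𝓡 n) ∞ M) {σ : ℝ → M} {t : ℝ}
    (hσ : MDifferentiableAt 𝓘(ℝ, ℝ) (𝓡 n) σ t) {p : M} {v : TangentSpace (𝓡 n) p}
    (h : (⟨σ t, mfderiv 𝓘(ℝ, ℝ) (𝓡 n) σ t (1 : ℝ)⟩ : TangentBundle (𝓡 n) M) = ⟨p, v⟩)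
    (hp : p ∈ φ.source) :
    HasDerivAt (fun u ↦ φ (σ u))
      (mfderiv (𝓡 n) 𝓘(ℝ, EuclideanSpace ℝ (Fin n)) φ p v : EuclideanSpace ℝ (Fin n)) t := by
  let F : TangentBundle (𝓡 n) M → EuclideanSpace ℝ (Fin n) :=
    fun z ↦ mfderiv (𝓡 n) 𝓘(ℝ, EuclideanSpace ℝ (Fin n)) φ z.1 z.2
  have h0 : σ t = p := congrArg TotalSpace.proj h
  have h1 := ((mdifferentiable_of_mem_maximalAtlas hφ).mdifferentiableAt (h0 ▸ hp)).hasMFDerivAt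
  let D : EuclideanSpace ℝ (Fin n) →L[ℝ] EuclideanSpace ℝ (Fin n) := mfderiv (𝓡 n) (𝓡 n) φ (σ t)
  let D' : ℝ →L[ℝ] EuclideanSpace ℝ (Fin n) := mfderiv 𝓘(ℝ, ℝ) (𝓡 n) σ t
  have h2 : HasFDerivAt (φ ∘ σ) (D.comp D') t :=
    hasMFDerivAt_iff_hasFDerivAt.1 (HasMFDerivAt.comp t h1 hσ.hasMFDerivAt)
  exact h2.hasDerivAt.congr_deriv (congrArg F h)

variable [RiemannianBundle (fun x : M ↦ TangentSpace (𝓡 n) x)]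

lemma IsGeodesicOn.mono {σ : ℝ → M} {s s' : Set ℝ} (h : IsGeodesicOn (n := n) σ s) (hs : s' ⊆ s) :
    IsGeodesicOn (n := n) σ s' :=
  ⟨h.1.mono hs, fun φ hφ t ht ↦ h.2 φ hφ t (hs ht)⟩

/-- Both terms of the geodesic equation scale by c². The case c = 0 is included and gives constant
curves. -/
lemma IsGeodesicOn.comp_mul {σ : ℝ → M} {s s' : Set ℝ} (h : IsGeodesicOn (n := n) σ s) (c : ℝ)
    (hs : ∀ t ∈ s', c * t ∈ s) : IsGeodesicOn (n := n) (fun t ↦ σ (c * t)) s' := by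
  refine ⟨h.1.comp (contMDiffOn_iff_contDiffOn.2 (by fun_prop)) hs, fun φ hφ t ht hσt a ↦ ?_⟩
  have h1 (b : Fin n) : (deriv fun u ↦ φ (σ (c * u)) b) =
      fun u ↦ c * deriv (fun u ↦ φ (σ u) b) (c * u) := by
    ext u
    exact deriv_comp_mul_left c (fun u ↦ φ (σ u) b) u
  have h2 : deriv (fun u ↦ c * deriv (fun u ↦ φ (σ u) a) (c * u)) t =
      c * (c * deriv (deriv fun u ↦ φ (σ u) a) (c * t)) := by
    rw [deriv_const_mul_field]
    congr 1
    exact deriv_comp_mul_left c (deriv fun u ↦ φ (σ u) a) t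
  have h3 := h.2 φ hφ (c * t) (hs t ht) hσt a
  simp_rw [h1]
  rw [h2]
  have h4 : ∑ b, ∑ d, christoffel φ a b d (φ (σ (c * t))) *
      (c * deriv (fun u ↦ φ (σ u) b) (c * t)) * (c * deriv (fun u ↦ φ (σ u) d) (c * t)) =
      c * (c * ∑ b, ∑ d, christoffel φ a b d (φ (σ (c * t))) *
        deriv (fun u ↦ φ (σ u) b) (c * t) * deriv (fun u ↦ φ (σ u) d) (c * t)) := by
    simp_rw [Finset.mul_sum]
    exact Finset.sum_congr rfl fun b _ ↦ Finset.sum_congr rfl fun d _ ↦ by ring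
  rw [h4, ← mul_add, ← mul_add, h3, mul_zero, mul_zero]

/-- The geodesic equation in a chart. -/
lemma IsGeodesicOn.hasDerivAt_deriv (hφ : φ ∈ IsManifold.maximalAtlas (𝓡 n) ∞ M) {σ : ℝ → M}
    {s : Set ℝ} (hs : IsOpen s) (h : IsGeodesicOn (n := n) σ s) {t : ℝ} (ht : t ∈ s)
    (hσt : σ t ∈ φ.source) :
    HasDerivAt (deriv fun u ↦ φ (σ u))
      (-chartConnection φ (φ (σ t)) (deriv (fun u ↦ φ (σ u)) t) (deriv (fun u ↦ φ (σ u)) t)) t := by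
  have hc := contDiffAt_chart_comp hφ hs h.1 ht hσt
  have hd : ∀ᶠ u in 𝓝 t, ∀ a, deriv (fun u ↦ φ (σ u) a) u = deriv (fun u ↦ φ (σ u)) u a := by
    have h1 : ∀ᶠ u in 𝓝 t, u ∈ s ∧ σ u ∈ φ.source :=
      (hs.eventually_mem ht).and ((h.1.contMDiffAt (hs.mem_nhds ht)).continuousAt.eventually_mem
        (φ.open_source.mem_nhds hσt))
    filter_upwards [h1] with u hu a
    have h2 := (contDiffAt_chart_comp hφ hs h.1 hu.1 hu.2).differentiableAt (by simp)
    exact (hasDerivAt_coord h2.hasDerivAt a).deriv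
  have h2 : DifferentiableAt ℝ (deriv fun u ↦ φ (σ u)) t :=
    (hc.derivWithin (m := 1) (WithTop.coe_le_coe.2 le_top)).differentiableAt (by simp)
  refine h2.hasDerivAt.congr_deriv ?_
  ext a
  have h3 : (deriv fun u ↦ φ (σ u) a) =ᶠ[𝓝 t] fun u ↦ deriv (fun u ↦ φ (σ u)) u a := by
    filter_upwards [hd] with u hu using hu a
  have h4 := h.2 φ hφ t ht hσt a
  rw [h3.deriv_eq, (hasDerivAt_coord h2.hasDerivAt a).deriv] at h4
  rw [PiLp.neg_apply, chartConnection_apply]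
  simp_rw [← mul_assoc]
  simp_rw [hd.self_of_nhds] at h4
  exact eq_neg_of_add_eq_zero_left h4

variable [IsContMDiffRiemannianBundle (𝓡 n) ∞ (EuclideanSpace ℝ (Fin n))
  (fun x : M ↦ TangentSpace (𝓡 n) x)]

/-- Local uniqueness of geodesics. -/
lemma IsGeodesicOn.eventuallyEq (hφ : φ ∈ IsManifold.maximalAtlas (𝓡 n) ∞ M) {σ τ : ℝ → M}
    {s : Set ℝ} (hs : IsOpen s) (hσ : IsGeodesicOn (n := n) σ s) (hτ : IsGeodesicOn (n := n) τ s)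
    {t : ℝ} (ht : t ∈ s) (hσt : σ t ∈ φ.source) (h0 : σ t = τ t)
    (h1 : deriv (fun u ↦ φ (σ u)) t = deriv (fun u ↦ φ (τ u)) t) : σ =ᶠ[𝓝 t] τ := by
  -- The geodesic spray: the equation becomes a first-order system for position and velocity, with a
  -- locally Lipschitz field.
  let v : EuclideanSpace ℝ (Fin n) × EuclideanSpace ℝ (Fin n) →
      EuclideanSpace ℝ (Fin n) × EuclideanSpace ℝ (Fin n) :=
    fun z ↦ (z.2, -chartConnection φ z.1 z.2 z.2)
  let Z (σ : ℝ → M) : ℝ → EuclideanSpace ℝ (Fin n) × EuclideanSpace ℝ (Fin n) :=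
    fun u ↦ (φ (σ u), deriv (fun u ↦ φ (σ u)) u)
  have hv : ContDiffAt ℝ 1 v (Z σ t) := by
    have h2 : ContDiffAt ℝ 1 (chartConnection φ) (φ (σ t)) :=
      ((contDiffOn_chartConnection hφ).contDiffAt
        (φ.open_target.mem_nhds (φ.map_source hσt))).of_le (by simp)
    have h3 : ContDiffAt ℝ 1 (fun z : EuclideanSpace ℝ (Fin n) × EuclideanSpace ℝ (Fin n) ↦
        chartConnection φ z.1) (Z σ t) := contDiffAt_comp_fst (z := Z σ t) h2
    exact contDiffAt_snd.prodMk ((h3.clm_apply contDiffAt_snd).clm_apply contDiffAt_snd).neg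
  obtain ⟨K, U, hU, hK⟩ := hv.exists_lipschitzOnWith
  have hZ0 : Z σ t = Z τ t := Prod.ext (congrArg φ h0) h1
  have hev (σ : ℝ → M) (hσ : IsGeodesicOn (n := n) σ s) (hσt : σ t ∈ φ.source)
      (hZU : U ∈ 𝓝 (Z σ t)) : ∀ᶠ u in 𝓝 t, HasDerivAt (Z σ) (v (Z σ u)) u ∧ Z σ u ∈ U := by
    have h2 : ∀ᶠ u in 𝓝 t, u ∈ s ∧ σ u ∈ φ.source :=
      (hs.eventually_mem ht).and ((hσ.1.contMDiffAt (hs.mem_nhds ht)).continuousAt.eventually_mem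
        (φ.open_source.mem_nhds hσt))
    have h3 (u : ℝ) (hu : u ∈ s ∧ σ u ∈ φ.source) : HasDerivAt (Z σ) (v (Z σ u)) u :=
      ((contDiffAt_chart_comp hφ hs hσ.1 hu.1 hu.2).differentiableAt (by simp)).hasDerivAt.prodMk
        (hσ.hasDerivAt_deriv hφ hs hu.1 hu.2)
    have h4 := (h3 t h2.self_of_nhds).continuousAt.eventually_mem hZU
    filter_upwards [h2, h4] with u hu hu' using ⟨h3 u hu, hu'⟩
  have key := ODE_solution_unique_of_eventually (v := fun _ ↦ v) (s := fun _ ↦ U)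
    (Filter.Eventually.of_forall fun _ ↦ hK) (hev σ hσ hσt hU)
    (hev τ hτ (h0 ▸ hσt) (hZ0 ▸ hU)) hZ0
  have h2 (σ : ℝ → M) (hσ : IsGeodesicOn (n := n) σ s) (hσt : σ t ∈ φ.source) :
      ∀ᶠ u in 𝓝 t, σ u ∈ φ.source :=
    (hσ.1.contMDiffAt (hs.mem_nhds ht)).continuousAt.eventually_mem (φ.open_source.mem_nhds hσt)
  filter_upwards [key, h2 σ hσ hσt, h2 τ hτ (h0 ▸ hσt)] with u hu h3 h4
  exact φ.injOn h3 h4 (congrArg Prod.fst hu)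

/-- Uniqueness of geodesics. -/
lemma IsGeodesicOn.eqOn (hφ : φ ∈ IsManifold.maximalAtlas (𝓡 n) ∞ M) {σ τ : ℝ → M}
    {s : Set ℝ} (hs : IsOpen s) (hs' : IsPreconnected s) (hσ : IsGeodesicOn (n := n) σ s)
    (hτ : IsGeodesicOn (n := n) τ s) {t : ℝ} (ht : t ∈ s) (hσt : σ t ∈ φ.source) (h0 : σ t = τ t)
    (h1 : deriv (fun u ↦ φ (σ u)) t = deriv (fun u ↦ φ (τ u)) t) : EqOn σ τ s := by
  -- The set of times near which the curves agree is open, and relatively closed in s: at a limit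
  -- point values and velocities agree by continuity, and local uniqueness applies.
  have key : s ⊆ {t | σ =ᶠ[𝓝 t] τ} := by
    refine hs'.subset_of_closure_inter_subset ?_ ⟨t, ht, hσ.eventuallyEq hφ hs hτ ht hσt h0 h1⟩ ?_
    · exact isOpen_iff_mem_nhds.2 fun u hu ↦ Filter.Eventually.eventually_nhds hu
    · rintro u ⟨hu, hus⟩
      have hf : ∃ᶠ x in 𝓝 u, σ =ᶠ[𝓝 x] τ := mem_closure_iff_frequently.1 hu
      have hc (σ : ℝ → M) (hσ : IsGeodesicOn (n := n) σ s) : ContinuousAt σ u :=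
        (hσ.1.contMDiffAt (hs.mem_nhds hus)).continuousAt
      have h2 : σ u = τ u := tendsto_nhds_unique_of_frequently_eq (hc σ hσ) (hc τ hτ)
        (hf.mono fun x hx ↦ hx.self_of_nhds)
      have hψ := IsManifold.chart_mem_maximalAtlas (I := 𝓡 n) (n := ∞) (σ u)
      have hsrc := mem_chart_source (EuclideanSpace ℝ (Fin n)) (σ u)
      refine hσ.eventuallyEq hψ hs hτ hus hsrc h2 ?_
      refine tendsto_nhds_unique_of_frequently_eq
        (hσ.hasDerivAt_deriv hψ hs hus hsrc).continuousAt
        (hτ.hasDerivAt_deriv hψ hs hus (h2 ▸ hsrc)).continuousAt (hf.mono fun x hx ↦ ?_)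
      exact Filter.EventuallyEq.deriv_eq (hx.fun_comp _)
  exact fun u hu ↦ (key hu).self_of_nhds

end Geodesics

/-! ### Normal charts provide normal metrics -/

section NormalCharts

variable {n : ℕ} {M : Type*} [MetricSpace M] [ChartedSpace (EuclideanSpace ℝ (Fin n)) M]
  [IsManifold (𝓡 n) ∞ M]
  {φ : OpenPartialHomeomorph M (EuclideanSpace ℝ (Fin n))}
  [RiemannianBundle (fun x : M ↦ TangentSpace (𝓡 n) x)]

lemma chartMetric_mfderiv (hφ : φ ∈ IsManifold.maximalAtlas (𝓡 n) ∞ M) {x : M}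
    (hx : x ∈ φ.source) (v w : TangentSpace (𝓡 n) x) :
    chartMetric φ (φ x) (mfderiv (𝓡 n) 𝓘(ℝ, EuclideanSpace ℝ (Fin n)) φ x v)
      (mfderiv (𝓡 n) 𝓘(ℝ, EuclideanSpace ℝ (Fin n)) φ x w) = inner ℝ v w := by
  obtain ⟨y, hy, rfl⟩ : ∃ y ∈ φ.target, φ.symm y = x := ⟨φ x, φ.map_source hx, φ.left_inv hx⟩
  have h (v : TangentSpace (𝓡 n) (φ.symm y)) : chartLift φ y
      (mfderiv (𝓡 n) 𝓘(ℝ, EuclideanSpace ℝ (Fin n)) φ (φ.symm y) v) = v := by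
    classical
    -- Smoothness plays no role here, so v is extended by zero to a vector field.
    have h1 := chartLift_chartField hφ (Function.update 0 (φ.symm y) v) hy
    unfold chartField at h1
    rw [Function.update_self] at h1
    exact h1
  have h2 : chartMetric φ (φ (φ.symm y)) = chartMetric φ y := by rw [φ.right_inv hy]
  rw [h2]
  exact (chartMetric_eq_inner y _ _).trans (congrArg₂ (inner ℝ) (h v) (h w))

lemma chartMetric_chartField (hφ : φ ∈ IsManifold.maximalAtlas (𝓡 n) ∞ M)
    (A : (x : M) → TangentSpace (𝓡 n) x) {y : EuclideanSpace ℝ (Fin n)} (hy : y ∈ φ.target) :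
    chartMetric φ y (chartField φ A y) (chartField φ A y) = ‖A (φ.symm y)‖ ^ 2 := by
  rw [chartMetric_eq_inner, chartLift_chartField hφ A hy, real_inner_self_eq_norm_sq]

variable [IsContMDiffRiemannianBundle (𝓡 n) ∞ (EuclideanSpace ℝ (Fin n))
  (fun x : M ↦ TangentSpace (𝓡 n) x)]

/-- Rescaling of geodesics. -/
lemma IsGeodesicOn.apply_eq_of_smul (hφ : φ ∈ IsManifold.maximalAtlas (𝓡 n) ∞ M) {σ τ : ℝ → M}
    {ε δ : ℝ} (hε : 0 < ε) (hδ : 0 < δ) (hσ : IsGeodesicOn (n := n) σ (Ioo (-ε) (1 + ε)))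
    (hτ : IsGeodesicOn (n := n) τ (Ioo (-δ) (1 + δ))) {p : M} (hp : p ∈ φ.source)
    {v : TangentSpace (𝓡 n) p} {t : ℝ} (ht : t ∈ Icc (0 : ℝ) 1)
    (hσ0 : (⟨σ 0, mfderiv 𝓘(ℝ, ℝ) (𝓡 n) σ 0 (1 : ℝ)⟩ : TangentBundle (𝓡 n) M) = ⟨p, v⟩)
    (hτ0 : (⟨τ 0, mfderiv 𝓘(ℝ, ℝ) (𝓡 n) τ 0 (1 : ℝ)⟩ : TangentBundle (𝓡 n) M) = ⟨p, t • v⟩) :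
    τ 1 = σ t := by
  have hm : 0 < min ε δ := lt_min hε hδ
  -- The two geodesics come with different margins around [0, 1]; the smaller one serves both.
  have hτ' : IsGeodesicOn (n := n) τ (Ioo (-min ε δ) (1 + min ε δ)) :=
    hτ.mono (Ioo_subset_Ioo (by linarith [min_le_right ε δ]) (by linarith [min_le_right ε δ]))
  have h0 : (0 : ℝ) ∈ Ioo (-min ε δ) (1 + min ε δ) := ⟨by linarith, by linarith⟩
  have hσ' : IsGeodesicOn (n := n) (fun s ↦ σ (t * s)) (Ioo (-min ε δ) (1 + min ε δ)) :=
    hσ.comp_mul t fun s hs ↦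
      Ioo_subset_Ioo (by linarith [min_le_left ε δ]) (by linarith [min_le_left ε δ])
        ((convex_Ioo _ _).smul_mem_of_zero_mem h0 hs ht)
  have h1 : (1 : ℝ) ∈ Ioo (-min ε δ) (1 + min ε δ) := ⟨by linarith, by linarith⟩
  have hdiff {σ : ℝ → M} {ε : ℝ} (hε : 0 < ε) (hσ : IsGeodesicOn (n := n) σ (Ioo (-ε) (1 + ε))) :
      MDifferentiableAt 𝓘(ℝ, ℝ) (𝓡 n) σ 0 :=
    (hσ.1.contMDiffAt (Ioo_mem_nhds (by linarith) (by linarith))).mdifferentiableAt (by simp)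
  have hσp : σ 0 = p := congrArg TotalSpace.proj hσ0
  have hτp : τ 0 = p := congrArg TotalSpace.proj hτ0
  have hd1 := hasDerivAt_chart_of_eq hφ (hdiff hδ hτ) hτ0 hp
  have hd2 := hasDerivAt_chart_of_eq hφ (hdiff hε hσ) hσ0 hp
  have hd3 : HasDerivAt (fun s ↦ φ (σ (t * s)))
      (t • (mfderiv (𝓡 n) 𝓘(ℝ, EuclideanSpace ℝ (Fin n)) φ p v : EuclideanSpace ℝ (Fin n))) 0 := by
    have h2 : HasDerivAt (fun s : ℝ ↦ t * s) t 0 := by simpa using (hasDerivAt_id (0 : ℝ)).const_mul t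
    rw [← mul_zero t] at hd2
    exact hd2.scomp (0 : ℝ) h2
  have h4 : (mfderiv (𝓡 n) 𝓘(ℝ, EuclideanSpace ℝ (Fin n)) φ p (t • v) : EuclideanSpace ℝ (Fin n)) =
      t • (mfderiv (𝓡 n) 𝓘(ℝ, EuclideanSpace ℝ (Fin n)) φ p v : EuclideanSpace ℝ (Fin n)) :=
    map_smul _ _ _
  have h5 := hτ'.eqOn hφ isOpen_Ioo isPreconnected_Ioo hσ' h0 (hτp ▸ hp)
    (by rw [hτp, mul_zero, hσp]) (by rw [hd1.deriv, hd3.deriv, h4]) h1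
  simpa using h5

/-- In a normal chart, the rays from the origin are geodesics and the metric at the origin is the
inner product. -/
lemma IsNormalChart.chart_eq {p : M} {r : ℝ} (hr : 0 < r) (hφ : IsNormalChart φ p r) :
    φ p = 0 ∧ (∀ y ∈ Metric.ball (0 : EuclideanSpace ℝ (Fin n)) r, chartConnection φ y y y = 0) ∧
      ∀ u v, chartMetric φ 0 u v = inner ℝ u v := by
  obtain ⟨hm, hs, ht, e, he⟩ := hφ
  have hp : p ∈ φ.source := hs ▸ Metric.mem_ball_self hr
  have he' : ∀ y ∈ Metric.ball (0 : EuclideanSpace ℝ (Fin n)) r,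
      IsExp p (e.repr.symm y) (φ.symm y) := by
    intro y hy
    rw [← e.sum_repr_symm]
    exact he y (ht ▸ hy)
  -- The definition supplies a separate geodesic for each y, known only at time 1. Rescaling shows
  -- that the one for y passes through the point with coordinates ty at time t.
  have hray : ∀ y ∈ Metric.ball (0 : EuclideanSpace ℝ (Fin n)) r, ∃ σ : ℝ → M, ∃ ε > 0,
      IsGeodesicOn (n := n) σ (Ioo (-ε) (1 + ε)) ∧ σ 0 = p ∧
      HasDerivAt (fun s ↦ φ (σ s)) (mfderiv (𝓡 n) 𝓘(ℝ, EuclideanSpace ℝ (Fin n)) φ p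
        (e.repr.symm y) : EuclideanSpace ℝ (Fin n)) 0 ∧
      ∀ t ∈ Icc (0 : ℝ) 1, σ t ∈ φ.source ∧ φ (σ t) = t • y := by
    intro y hy
    obtain ⟨σ, ε, hε, hσ, hσ0, -⟩ := he' y hy
    refine ⟨σ, ε, hε, hσ, congrArg TotalSpace.proj hσ0, hasDerivAt_chart_of_eq hm
      ((hσ.1.contMDiffAt (Ioo_mem_nhds (by linarith) (by linarith))).mdifferentiableAt (by simp))
      hσ0 hp, fun t h ↦ ?_⟩
    have hty : t • y ∈ Metric.ball (0 : EuclideanSpace ℝ (Fin n)) r := by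
      rw [mem_ball_zero_iff] at hy ⊢
      rw [norm_smul, Real.norm_of_nonneg h.1]
      nlinarith [norm_nonneg y, h.1, h.2]
    obtain ⟨τ, δ, hδ, hτ, hτ0, hτ1⟩ := he' (t • y) hty
    rw [map_smul] at hτ0
    rw [← hσ.apply_eq_of_smul hm hε hδ hτ hp h hσ0 hτ0, hτ1]
    exact ⟨φ.map_target (ht ▸ hty), φ.right_inv (ht ▸ hty)⟩
  have h0 : φ p = 0 := by
    obtain ⟨σ, -, -, -, h0, -, h1⟩ := hray 0 (Metric.mem_ball_self hr)
    rw [← h0, (h1 0 (by simp)).2, smul_zero]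
  have hderiv : ∀ y ∈ Metric.ball (0 : EuclideanSpace ℝ (Fin n)) r, chartConnection φ y y y = 0 ∧
      (mfderiv (𝓡 n) 𝓘(ℝ, EuclideanSpace ℝ (Fin n)) φ p (e.repr.symm y) :
        EuclideanSpace ℝ (Fin n)) = y := by
    intro y hy
    obtain ⟨σ, ε, hε, hσ, hσ0, hd, hσt⟩ := hray y hy
    have hmem : ∀ t ∈ Icc (0 : ℝ) 1, t ∈ Ioo (-ε) (1 + ε) := fun t ht ↦
      ⟨by linarith [ht.1], by linarith [ht.2]⟩
    -- The curve is known to be a ray only on [0, 1], so at the endpoints its derivatives are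
    -- identified by one-sided uniqueness.
    have hu : ∀ t ∈ Icc (0 : ℝ) 1, UniqueDiffWithinAt ℝ (Icc (0 : ℝ) 1) t :=
      uniqueDiffOn_Icc one_pos
    have h1 : ∀ t ∈ Icc (0 : ℝ) 1, deriv (fun s ↦ φ (σ s)) t = y := by
      intro t ht
      have h2 := (contDiffAt_chart_comp hm isOpen_Ioo hσ.1 (hmem t ht)
        (hσt t ht).1).differentiableAt (by simp)
      have h3 : HasDerivAt (fun s : ℝ ↦ s • y) y t := by
        simpa using (hasDerivAt_id t).smul_const y
      exact (hu t ht).eq_deriv _ h2.hasDerivAt.hasDerivWithinAt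
        (h3.hasDerivWithinAt.congr (fun s hs ↦ (hσt s hs).2) (hσt t ht).2)
    have h1mem : (1 : ℝ) ∈ Icc (0 : ℝ) 1 := by simp
    have h4 := hσ.hasDerivAt_deriv hm isOpen_Ioo (hmem 1 h1mem) (hσt 1 h1mem).1
    rw [(hσt 1 h1mem).2, h1 1 h1mem, one_smul] at h4
    have h5 := (hu 1 h1mem).eq_deriv _ h4.hasDerivWithinAt
      ((hasDerivWithinAt_const (1 : ℝ) (Icc (0 : ℝ) 1) y).congr h1 (h1 1 h1mem))
    refine ⟨neg_eq_zero.1 h5, ?_⟩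
    rw [← hd.deriv]
    exact h1 0 (by simp)
  refine ⟨h0, fun y hy ↦ (hderiv y hy).1, fun u v ↦ ?_⟩
  have hiso (u : EuclideanSpace ℝ (Fin n)) :
      (mfderiv (𝓡 n) 𝓘(ℝ, EuclideanSpace ℝ (Fin n)) φ p (e.repr.symm u) :
        EuclideanSpace ℝ (Fin n)) = u := by
    -- By linearity the differential need only be known on a multiple of u inside the ball.
    obtain ⟨c, hc, hcu⟩ : ∃ c : ℝ, c ≠ 0 ∧ c • u ∈ Metric.ball (0 : EuclideanSpace ℝ (Fin n)) r := by
      refine ⟨r / (‖u‖ + 1), by positivity, ?_⟩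
      rw [mem_ball_zero_iff, norm_smul, Real.norm_of_nonneg (by positivity), div_mul_eq_mul_div,
        div_lt_iff₀ (by positivity)]
      nlinarith
    have h1 := (hderiv _ hcu).2
    rw [map_smul] at h1
    have h2 : c • (mfderiv (𝓡 n) 𝓘(ℝ, EuclideanSpace ℝ (Fin n)) φ p (e.repr.symm u) :
        EuclideanSpace ℝ (Fin n)) = c • u := (map_smul _ _ _).symm.trans h1
    exact smul_right_injective _ hc h2
  have h6 := chartMetric_mfderiv hm hp (e.repr.symm u) (e.repr.symm v)
  rw [hiso u, hiso v, h0] at h6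
  rw [h6, LinearIsometryEquiv.inner_map_map]

theorem IsNormalChart.isNormalMetric {p : M} {r : ℝ} (hr : 0 < r) (hφ : IsNormalChart φ p r) :
    IsNormalMetric (chartMetric φ) (chartConnection φ) r := by
  obtain ⟨-, h1, h2⟩ := hφ.chart_eq hr
  obtain ⟨hm, hs, ht, -⟩ := hφ
  rw [← ht] at h1
  constructor
  all_goals try rw [← ht]
  · exact fun y hy ↦ differentiableAt_chartMetric hm hy
  · exact fun y hy ↦ differentiableAt_chartConnection hm hy
  · exact fun y hy ↦ chartMetric_symm y
  · exact fun y hy v hv ↦ chartMetric_pos hm hy hv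
  · exact fun y hy ↦ chartConnection_symm y
  · exact fun y hy ↦ chart_koszul hm hy
  · exact h1
  · exact h2

lemma chartMetric_self_nonneg (y v : EuclideanSpace ℝ (Fin n)) : 0 ≤ chartMetric φ y v v := by
  rw [chartMetric_eq_inner]
  exact real_inner_self_nonneg

lemma CovDerivBoundedBy.sqrt_le {A : (x : M) → TangentSpace (𝓡 n) x}
    (hA : ContMDiff (𝓡 n) (𝓡 n).tangent ∞ (fun x ↦ (⟨x, A x⟩ : TangentBundle (𝓡 n) M)))
    {c : ℝ} (h : CovDerivBoundedBy A c) (hφ : φ ∈ IsManifold.maximalAtlas (𝓡 n) ∞ M)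
    {y : EuclideanSpace ℝ (Fin n)} (hy : y ∈ φ.target) (v : EuclideanSpace ℝ (Fin n)) :
    √(chartMetric φ y
        (fderiv ℝ (chartField φ A) y v + chartConnection φ y v (chartField φ A y))
        (fderiv ℝ (chartField φ A) y v + chartConnection φ y v (chartField φ A y))) ≤
      c * √(chartMetric φ y v v) := by
  have h1 := chartMetric_contraction_le hφ hy _ (fun _ ↦ v) (covDeriv_contraction
    (((contDiffOn_chartField hφ hA).contDiffAt (φ.open_target.mem_nhds hy)).differentiableAt
      (by simp)) v)
  have h2 := h φ hφ (φ.symm y) (φ.map_target hy)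
  rw [φ.right_inv hy] at h2
  simp only [Finset.univ_unique, Finset.prod_const, Finset.card_singleton, pow_one] at h1
  exact h1.trans (mul_le_mul_of_nonneg_right h2 (Real.sqrt_nonneg _))

/-- The tensor norm bounds |R(v, w)v| by c|v|²|w|; Cauchy–Schwarz against w gives the remaining
factor. -/
lemma CurvatureDerivBoundedBy.abs_le {c : ℝ} (h : CurvatureDerivBoundedBy n M 0 c)
    (hφ : φ ∈ IsManifold.maximalAtlas (𝓡 n) ∞ M)
    {y : EuclideanSpace ℝ (Fin n)} (hy : y ∈ φ.target) (v w : EuclideanSpace ℝ (Fin n)) :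
    |chartMetric φ y w (connectionCurvature (chartConnection φ) y v v w)| ≤
      c * chartMetric φ y v v * chartMetric φ y w w := by
  have h1 := chartMetric_contraction_le hφ hy _ ![v, v, w] (riemannComp_contraction hφ hy v v w)
  have h2 : tensorNorm φ (riemannComp φ) y ≤ c := by
    have := h φ hφ (φ.symm y) (φ.map_target hy)
    rwa [φ.right_inv hy] at this
  have hprod : ∏ i, √(chartMetric φ y (![v, v, w] i) (![v, v, w] i)) =
      chartMetric φ y v v * √(chartMetric φ y w w) := by
    simp [Fin.prod_univ_three, Real.mul_self_sqrt (chartMetric_self_nonneg y v)]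
  rw [hprod] at h1
  have h3 := h1.trans (mul_le_mul_of_nonneg_right h2
    (mul_nonneg (chartMetric_self_nonneg y v) (Real.sqrt_nonneg _)))
  have h4 : |chartMetric φ y w (connectionCurvature (chartConnection φ) y v v w)| ≤
      √(chartMetric φ y w w) * √(chartMetric φ y (connectionCurvature (chartConnection φ) y v v w)
        (connectionCurvature (chartConnection φ) y v v w)) := by
    simp only [chartMetric_eq_inner, real_inner_self_eq_norm_sq, Real.sqrt_sq (norm_nonneg _)]
    exact abs_real_inner_le_norm _ _
  refine h4.trans ((mul_le_mul_of_nonneg_left h3 (Real.sqrt_nonneg _)).trans_eq ?_)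
  have := Real.mul_self_sqrt (chartMetric_self_nonneg (φ := φ) y w)
  linear_combination (c * chartMetric φ y v v) * this

end NormalCharts

/-! ### Smoothness of integral curves, and distance to the centre of a normal chart -/

section Distance

variable {n : ℕ} {M : Type*} [MetricSpace M] [ChartedSpace (EuclideanSpace ℝ (Fin n)) M]
  [IsManifold (𝓡 n) ∞ M]
  {φ : OpenPartialHomeomorph M (EuclideanSpace ℝ (Fin n))}

/-- Integral curves of smooth vector fields are smooth. -/
lemma IsMIntegralCurve.contMDiff_of_contMDiff {A : (x : M) → TangentSpace (𝓡 n) x}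
    (hA : ContMDiff (𝓡 n) (𝓡 n).tangent ∞ (fun x ↦ (⟨x, A x⟩ : TangentBundle (𝓡 n) M)))
    {γ : ℝ → M} (hγ : IsMIntegralCurve γ A) : ContMDiff 𝓘(ℝ, ℝ) (𝓡 n) ∞ γ := by
  intro t
  have hψ := IsManifold.chart_mem_maximalAtlas (I := 𝓡 n) (n := ∞) (γ t)
  set ψ := chartAt (EuclideanSpace ℝ (Fin n)) (γ t)
  have hsrc : γ t ∈ ψ.source := mem_chart_source (EuclideanSpace ℝ (Fin n)) (γ t)
  have hev : ∀ᶠ s in 𝓝 t, γ s ∈ ψ.source :=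
    hγ.continuous.continuousAt.eventually_mem (ψ.open_source.mem_nhds hsrc)
  obtain ⟨δ, hδ, hδ'⟩ := Metric.nhds_basis_closedBall.eventually_iff.1 hev
  rw [Real.closedBall_eq_Icc] at hδ'
  have hnhds : Icc (t - δ) (t + δ) ∈ 𝓝 t := Icc_mem_nhds (by linarith) (by linarith)
  -- In the chart the curve solves an autonomous equation with smooth right-hand side, so its
  -- regularity bootstraps.
  have h1 : ContDiffOn ℝ ∞ (fun s ↦ ψ (γ s)) (Icc (t - δ) (t + δ)) := by
    refine ODE.contDiffOn_enat_Icc_of_hasDerivWithinAt (n := ⊤) (f := fun _ ↦ chartField ψ A)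
      (u := ψ.target) ?_ (fun s hs ↦ (hasDerivAt_chart hψ (hδ' hs) (hγ s)).hasDerivWithinAt)
      (fun s hs ↦ ψ.map_source (hδ' hs))
    exact (contDiffOn_chartField hψ hA).comp contDiffOn_snd (fun z hz ↦ hz.2)
  have h2 : ContMDiffAt 𝓘(ℝ, ℝ) (𝓡 n) ∞ (fun s ↦ ψ (γ s)) t :=
    (h1.contDiffAt hnhds).contMDiffAt
  have h3 := (contMDiffOn_symm_of_mem_maximalAtlas hψ).contMDiffAt
    (ψ.open_target.mem_nhds (ψ.map_source hsrc))
  refine (h3.comp t h2).congr_of_eventuallyEq ?_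
  filter_upwards [hev] with s hs using (ψ.left_inv hs).symm

variable [RiemannianBundle (fun x : M ↦ TangentSpace (𝓡 n) x)]

lemma edist_le_of_norm_mfderiv_le [IsRiemannianManifold (𝓡 n) M] {γ : ℝ → M} {a b c : ℝ}
    (hab : a ≤ b) (hγ : ContMDiffOn 𝓘(ℝ, ℝ) (𝓡 n) 1 γ (Icc a b))
    (hc : ∀ t ∈ Ioo a b, ‖mfderiv 𝓘(ℝ, ℝ) (𝓡 n) γ t (1 : ℝ)‖ ≤ c) :
    edist (γ a) (γ b) ≤ ENNReal.ofReal (c * (b - a)) := by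
  rw [IsRiemannianManifold.out (I := 𝓡 n) (γ a) (γ b)]
  refine (riemannianEDist_le_pathELength hγ rfl rfl hab).trans ?_
  rw [pathELength_eq_lintegral_mfderiv_Ioo]
  have h : ∀ t ∈ Ioo a b, ‖mfderiv 𝓘(ℝ, ℝ) (𝓡 n) γ t (1 : ℝ)‖ₑ ≤ ENNReal.ofReal c := by
    intro t ht
    rw [← ofReal_norm]
    exact ENNReal.ofReal_le_ofReal (hc t ht)
  refine (MeasureTheory.setLIntegral_mono measurable_const h).trans_eq ?_
  rw [MeasureTheory.setLIntegral_const, Real.volume_Ioo, ENNReal.ofReal_mul' (by linarith)]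

lemma dist_le_of_norm_mfderiv_le [IsRiemannianManifold (𝓡 n) M] {γ : ℝ → M} {a b c : ℝ}
    (hab : a ≤ b) (hγ : ContMDiffOn 𝓘(ℝ, ℝ) (𝓡 n) 1 γ (Icc a b))
    (hc0 : 0 ≤ c) (hc : ∀ t ∈ Ioo a b, ‖mfderiv 𝓘(ℝ, ℝ) (𝓡 n) γ t (1 : ℝ)‖ ≤ c) :
    dist (γ a) (γ b) ≤ c * (b - a) := by
  have h := edist_le_of_norm_mfderiv_le hab hγ hc
  rw [edist_dist] at h
  exact (ENNReal.ofReal_le_ofReal_iff (mul_nonneg hc0 (by linarith))).1 h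

/-- Cauchy–Schwarz against the radial vector, rewritten by the Gauss lemma: the Euclidean radial
speed never exceeds the Riemannian speed. -/
lemma IsNormalMetric.abs_inner_le {E : Type*} [NormedAddCommGroup E] [InnerProductSpace ℝ E]
    {g : E → E →L[ℝ] E →L[ℝ] ℝ} {Γ : E → E →L[ℝ] E →L[ℝ] E} {r : ℝ} (h : IsNormalMetric g Γ r)
    {y : E} (hy : y ∈ Metric.ball (0 : E) r) (w : E) :
    |(inner ℝ y w : ℝ)| ≤ ‖y‖ * √(g y w w) := by
  have h1 := h.abs_le hy y w
  rwa [h.gauss hy, h.apply_self hy, real_inner_self_eq_norm_sq, Real.sqrt_sq (norm_nonneg _)] at h1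

variable [IsContMDiffRiemannianBundle (𝓡 n) ∞ (EuclideanSpace ℝ (Fin n))
  (fun x : M ↦ TangentSpace (𝓡 n) x)]

/-- The ray to y has constant speed ‖y‖ on [0, 1], hence length ‖y‖. -/
lemma IsNormalChart.dist_symm_le [IsRiemannianManifold (𝓡 n) M] {p : M} {r : ℝ} (hr : 0 < r)
    (hφ : IsNormalChart φ p r) {y : EuclideanSpace ℝ (Fin n)} (hy : y ∈ Metric.ball 0 r) :
    dist p (φ.symm y) ≤ ‖y‖ := by
  have hN := hφ.isNormalMetric hr
  have h0 := (hφ.chart_eq hr).1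
  obtain ⟨hm, hs, ht, -⟩ := hφ
  have hmem : ∀ t ∈ Icc (0 : ℝ) 1, t • y ∈ φ.target := fun t h ↦
    ht ▸ IsNormalMetric.smul_mem_ball hy h
  have hsmooth : ContMDiffOn 𝓘(ℝ, ℝ) (𝓡 n) 1 (fun t : ℝ ↦ φ.symm (t • y)) (Icc 0 1) := by
    refine ((contMDiffOn_symm_of_mem_maximalAtlas hm).of_le (by simp)).comp ?_ hmem
    exact contMDiffOn_iff_contDiffOn.2 (by fun_prop)
  have h := dist_le_of_norm_mfderiv_le zero_le_one hsmooth (norm_nonneg y) fun t h ↦ ?_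
  · have hp : φ.symm (0 : EuclideanSpace ℝ (Fin n)) = p := by
      rw [← h0, φ.left_inv (hs ▸ Metric.mem_ball_self hr)]
    simpa [hp] using h
  · have h1 := ((mdifferentiable_of_mem_maximalAtlas hm).mdifferentiableAt_symm
      (hmem t ⟨h.1.le, h.2.le⟩)).hasMFDerivAt
    have h2 : HasDerivAt (fun t : ℝ ↦ t • y) y t := by simpa using (hasDerivAt_id t).smul_const y
    have h3 := h1.comp t h2.hasFDerivAt.hasMFDerivAt
    have h4 : mfderiv 𝓘(ℝ, ℝ) (𝓡 n) (fun t : ℝ ↦ φ.symm (t • y)) t (1 : ℝ) =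
        chartLift φ (t • y) ((1 : ℝ) • y) := congrArg (fun L ↦ L (1 : ℝ)) h3.mfderiv
    rw [h4, one_smul]
    have h5 := hN.apply_self (IsNormalMetric.smul_mem_ball hy ⟨h.1.le, h.2.le⟩)
    simp only [map_smul, smul_apply, smul_eq_mul, inner_smul_left, inner_smul_right, conj_trivial,
      chartMetric_eq_inner, real_inner_self_eq_norm_sq] at h5
    have h6 : ‖chartLift φ (t • y) y‖ ^ 2 = ‖y‖ ^ 2 := by
      have : t ≠ 0 := h.1.ne'
      field_simp at h5
      exact h5
    exact ((sq_eq_sq₀ (norm_nonneg _) (norm_nonneg _)).1 h6).le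

lemma hasDerivAt_chart_of_mdifferentiableAt (hφ : φ ∈ IsManifold.maximalAtlas (𝓡 n) ∞ M)
    {γ : ℝ → M} {t : ℝ} (hγ : MDifferentiableAt 𝓘(ℝ, ℝ) (𝓡 n) γ t) (ht : γ t ∈ φ.source) :
    ∃ w : EuclideanSpace ℝ (Fin n), HasDerivAt (fun s ↦ φ (γ s)) w t ∧
      chartMetric φ (φ (γ t)) w w = ‖mfderiv 𝓘(ℝ, ℝ) (𝓡 n) γ t (1 : ℝ)‖ ^ 2 := by
  refine ⟨_, hasDerivAt_chart_of_eq hφ hγ rfl ht, ?_⟩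
  exact (chartMetric_mfderiv hφ ht _ _).trans (real_inner_self_eq_norm_sq _)

/-- Along any curve from p inside the chart the coordinate norm grows by at most the length, and a
curve shorter than r cannot leave the ball. -/
lemma IsNormalChart.norm_chart_le [IsRiemannianManifold (𝓡 n) M] {p : M} {r : ℝ} (hr : 0 < r)
    (hφ : IsNormalChart φ p r) {q : M} (hq : q ∈ Metric.ball p r) : ‖φ q‖ ≤ dist p q := by
  have hN := hφ.isNormalMetric hr
  have h0 := (hφ.chart_eq hr).1
  obtain ⟨hm, hs, ht, -⟩ := hφ
  refine le_of_forall_pos_le_add fun δ hδ ↦ ?_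
  obtain ⟨s, hs1, hs2⟩ : ∃ s, dist p q < s ∧ s < min r (dist p q + δ / 2) :=
    exists_between (lt_min (by rwa [dist_comm]) (by linarith))
  have hs0 : 0 < s := dist_nonneg.trans_lt hs1
  have hedist : riemannianEDist (𝓡 n) p q < ENNReal.ofReal s := by
    rw [← IsRiemannianManifold.out (I := 𝓡 n) p q, edist_dist]
    exact (ENNReal.ofReal_lt_ofReal_iff hs0).2 hs1
  obtain ⟨γ, hγ0, hγ1, hγ, hlen⟩ := exists_lt_of_riemannianEDist_lt hedist
  have hsrc : ∀ t ∈ Icc (0 : ℝ) 1, γ t ∈ φ.source := by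
    intro t h
    have h1 : edist p (γ t) < ENNReal.ofReal r := by
      rw [IsRiemannianManifold.out (I := 𝓡 n) p (γ t)]
      refine ((riemannianEDist_le_pathELength (hγ.mono (Icc_subset_Icc_right h.2)) hγ0 rfl
        h.1).trans (pathELength_mono le_rfl h.2)).trans_lt (hlen.trans ?_)
      exact (ENNReal.ofReal_lt_ofReal_iff hr).2 (hs2.trans_le (min_le_left _ _))
    rw [edist_dist, ENNReal.ofReal_lt_ofReal_iff hr, dist_comm] at h1
    rw [hs]
    exact h1
  -- A smooth substitute for the norm; its value δ/2 at the start and the excess δ/2 allowed for the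
  -- length add up to δ.
  set F : ℝ → ℝ := fun t ↦ √(‖φ (γ t)‖ ^ 2 + (δ / 2) ^ 2) with hF
  have hφγ : ContDiffOn ℝ 1 (fun t ↦ φ (γ t)) (Icc 0 1) :=
    contMDiffOn_iff_contDiffOn.1
      (((contMDiffOn_of_mem_maximalAtlas hm).of_le (by simp)).comp hγ hsrc)
  have hFsmooth : ContDiffOn ℝ 1 F (Icc 0 1) :=
    ((hφγ.norm_sq ℝ).add contDiffOn_const).sqrt fun t _ ↦ by positivity
  have h1 := enorm_sub_le_lintegral_deriv_of_contDiffOn_Icc hFsmooth zero_le_one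
  rw [MeasureTheory.restrict_Ioo_eq_restrict_Icc.symm] at h1
  have h2 : ∀ t ∈ Ioo (0 : ℝ) 1, ‖deriv F t‖ₑ ≤ ‖mfderiv 𝓘(ℝ, ℝ) (𝓡 n) γ t (1 : ℝ)‖ₑ := by
    intro t h
    have ht' : t ∈ Icc (0 : ℝ) 1 := ⟨h.1.le, h.2.le⟩
    obtain ⟨w, hw, hw2⟩ := hasDerivAt_chart_of_mdifferentiableAt hm
      ((hγ.contMDiffAt (Icc_mem_nhds h.1 h.2)).mdifferentiableAt (by simp)) (hsrc t ht')
    have hd : HasDerivAt F (inner ℝ (φ (γ t)) w / F t) t := by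
      refine ((hw.norm_sq.add_const ((δ / 2) ^ 2)).sqrt (by positivity)).congr_deriv ?_
      simp only [hF]
      rw [mul_div_mul_left _ _ two_ne_zero]
    have hb : φ (γ t) ∈ Metric.ball (0 : EuclideanSpace ℝ (Fin n)) r :=
      ht ▸ φ.map_source (hsrc t ht')
    have h3 := hN.abs_inner_le hb w
    rw [hw2, Real.sqrt_sq (norm_nonneg _)] at h3
    have hFpos : 0 < F t := Real.sqrt_pos.2 (by positivity)
    have h4 : ‖φ (γ t)‖ ≤ F t := Real.le_sqrt_of_sq_le (by linarith [sq_nonneg (δ / 2)])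
    rw [← ofReal_norm, ← ofReal_norm]
    refine ENNReal.ofReal_le_ofReal ?_
    rw [hd.deriv, norm_div, Real.norm_eq_abs, Real.norm_of_nonneg hFpos.le, div_le_iff₀ hFpos,
      mul_comm _ (F t)]
    exact h3.trans (mul_le_mul_of_nonneg_right h4 (norm_nonneg _))
  have h3 : ‖F 1 - F 0‖ₑ ≤ ENNReal.ofReal s := by
    refine (h1.trans (MeasureTheory.setLIntegral_mono' measurableSet_Ioo h2)).trans ?_
    exact pathELength_eq_lintegral_mfderiv_Ioo.symm.trans_le hlen.le
  rw [← ofReal_norm, ENNReal.ofReal_le_ofReal_iff hs0.le] at h3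
  have hF0 : F 0 = δ / 2 := by
    simp only [hF, hγ0, h0, norm_zero]
    rw [zero_pow two_ne_zero, zero_add, Real.sqrt_sq (by positivity)]
  have hF1 : ‖φ q‖ ≤ F 1 := by
    rw [← hγ1]
    exact Real.le_sqrt_of_sq_le (by linarith [sq_nonneg (δ / 2)])
  have h4 := (le_abs_self _).trans h3
  have h5 := hs2.trans_le (min_le_right _ _)
  linarith

/-- In a normal chart, the distance to the center is the norm of the coordinates. -/
theorem IsNormalChart.dist_eq [IsRiemannianManifold (𝓡 n) M] {p : M} {r : ℝ} (hr : 0 < r)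
    (hφ : IsNormalChart φ p r) {q : M} (hq : q ∈ Metric.ball p r) : dist p q = ‖φ q‖ := by
  refine le_antisymm ?_ (hφ.norm_chart_le hr hq)
  have hq' : q ∈ φ.source := hφ.2.1 ▸ hq
  have h := hφ.dist_symm_le hr (hφ.2.2.1 ▸ φ.map_source hq')
  rwa [φ.left_inv hq'] at h

end Distance

/-! ### Existence time from a bound on the radial speed -/

section FlowInBall

variable {E : Type*} [NormedAddCommGroup E] [InnerProductSpace ℝ E] [FiniteDimensional ℝ E]

/-- A solution of an ordinary differential equation whose radial speed is at most `c` exists as long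
as it cannot leave the ball on which the equation is defined. -/
lemma exists_hasDerivAt_of_inner_le {B : E → E} {ρ r c : ℝ} (hρ : 0 < ρ) (hρr : ρ < r) (hc : 0 < c)
    (hB : ContDiffOn ℝ ∞ B (Metric.ball 0 r))
    (hle : ∀ y ∈ Metric.ball (0 : E) r, |(inner ℝ y (B y) : ℝ)| ≤ c * ‖y‖) :
    ∃ y : ℝ → E, y 0 = 0 ∧ ∀ t ∈ Ioo (-(ρ / (2 * c))) (ρ / (2 * c)),
      y t ∈ Metric.ball 0 r ∧ HasDerivAt y (B (y t)) t := by
  -- The cut-off field is smooth with compact support, hence globally Lipschitz and bounded. It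
  -- agrees with B on the ball of radius ρ/2 and obeys the same radial bound.
  let χ : ContDiffBump (0 : E) := ⟨ρ / 2, ρ, by linarith, by linarith⟩
  set V : E → E := fun y ↦ χ y • B y with hV
  have hsupp : tsupport V ⊆ Metric.closedBall 0 ρ :=
    (tsupport_smul_subset_left _ _).trans χ.tsupport_eq.subset
  have hVs : ContDiff ℝ ∞ V := by
    refine contMDiff_iff_contDiff.1 (contMDiff_of_tsupport fun x hx ↦ ?_)
    have hx' : x ∈ Metric.ball (0 : E) r := Metric.closedBall_subset_ball hρr (hsupp hx)
    exact (χ.contDiffAt.smul (hB.contDiffAt (Metric.isOpen_ball.mem_nhds hx'))).contMDiffAt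
  have hVc : HasCompactSupport V := χ.hasCompactSupport.smul_right
  obtain ⟨K, hK⟩ := hVs.lipschitzWith_of_hasCompactSupport hVc (by simp)
  obtain ⟨L, hL⟩ := hVc.exists_bound_of_continuous hVs.continuous
  have hVle (y : E) : |(inner ℝ y (V y) : ℝ)| ≤ c * ‖y‖ := by
    by_cases hy : y ∈ Metric.ball (0 : E) r
    · rw [hV, inner_smul_right, abs_mul, abs_of_nonneg χ.nonneg]
      exact (mul_le_of_le_one_left (abs_nonneg _) χ.le_one).trans (hle y hy)
    · have : χ y = 0 := χ.zero_of_le_dist (by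
        rw [Metric.mem_ball, not_lt] at hy
        exact hρr.le.trans hy)
      simp only [hV, this, zero_smul, inner_zero_right, abs_zero]
      positivity
  -- At radial speed c the ball of radius ρ/2 cannot be left before this time, so the cut-off is
  -- never felt.
  set τ : ℝ := ρ / (2 * c) with hτ
  have hτ0 : 0 < τ := by positivity
  have hPL : IsPicardLindelof (fun _ ↦ V) (tmin := -τ) (tmax := τ) ⟨0, by linarith, hτ0.le⟩ (0 : E)
      (L.toNNReal * τ.toNNReal) 0 L.toNNReal K := by
    refine .of_time_independent (fun x _ ↦ ?_) hK.lipschitzOnWith ?_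
    · exact (hL x).trans (Real.le_coe_toNNReal L)
    · simp [Real.coe_toNNReal _ hτ0.le]
  obtain ⟨y, hy0, hy⟩ := hPL.exists_eq_forall_mem_Icc_hasDerivWithinAt₀
  replace hy0 : y 0 = 0 := hy0
  replace hy : ∀ t ∈ Ioo (-τ) τ, HasDerivAt y (V (y t)) t := fun t ht ↦
    (hy t ⟨ht.1.le, ht.2.le⟩).hasDerivAt (Icc_mem_nhds ht.1 ht.2)
  have hpos : ∀ t ∈ Ico 0 τ, ‖y t‖ ≤ c * t := fun t ht ↦
    norm_le_of_inner_deriv_le (y' := fun t ↦ V (y t)) (T := t) hy0 hc.le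
      (fun s hs ↦ hy s ⟨by linarith [hs.1], hs.2.trans_lt ht.2⟩)
      (fun s _ ↦ (le_abs_self _).trans (hVle (y s))) ⟨ht.1, le_rfl⟩
  have hneg : ∀ t ∈ Ico 0 τ, ‖y (-t)‖ ≤ c * t := fun t ht ↦
    norm_le_of_inner_deriv_le (y := fun s ↦ y (-s)) (y' := fun s ↦ -V (y (-s))) (T := t)
      (by simpa using hy0) hc.le
      (fun s hs ↦ by
        have h1 := hy (-s) ⟨by linarith [hs.2, ht.2], by linarith [hs.1]⟩
        exact (h1.scomp s (hasDerivAt_neg s)).congr_deriv (neg_one_smul ℝ _))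
      (fun s _ ↦ by
        rw [inner_neg_right]
        exact (neg_le_abs _).trans (hVle (y (-s)))) ⟨ht.1, le_rfl⟩
  refine ⟨y, hy0, fun t ht ↦ ?_⟩
  have hn : ‖y t‖ ≤ c * |t| := by
    rcases le_total 0 t with h | h
    · rw [abs_of_nonneg h]
      exact hpos t ⟨h, ht.2⟩
    · rw [abs_of_nonpos h]
      simpa using hneg (-t) ⟨by linarith, by linarith [ht.1]⟩
  have hn2 : ‖y t‖ ≤ ρ / 2 := by
    refine hn.trans ((mul_le_mul_of_nonneg_left (abs_lt.2 ht).le hc.le).trans_eq ?_)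
    rw [hτ]
    field_simp
  refine ⟨mem_ball_zero_iff.2 (by linarith), (hy t ht).congr_deriv ?_⟩
  have : χ (y t) = 1 := χ.one_of_mem_closedBall (mem_closedBall_zero_iff.2 hn2)
  simp only [hV, this, one_smul]

end FlowInBall

/-! ### Uniform existence time and monotonicity of the distance -/

section Main

variable {n : ℕ} {M : Type*} [MetricSpace M] [ChartedSpace (EuclideanSpace ℝ (Fin n)) M]
  [IsManifold (𝓡 n) ∞ M]
  {φ : OpenPartialHomeomorph M (EuclideanSpace ℝ (Fin n))}
  [RiemannianBundle (fun x : M ↦ TangentSpace (𝓡 n) x)]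

lemma exists_isNormalChart_of_injectivityRadius_pos (h : 0 < injectivityRadius n M) :
    ∃ ρ > 0, ∀ p : M, ∃ r, ρ < r ∧
      ∃ φ : OpenPartialHomeomorph M (EuclideanSpace ℝ (Fin n)), IsNormalChart φ p r := by
  obtain ⟨ρ, h0, hρ⟩ := exists_between h
  have hfin : ρ ≠ ⊤ := hρ.ne_top
  refine ⟨ρ.toReal, ENNReal.toReal_pos h0.ne' hfin, fun p ↦ ?_⟩
  obtain ⟨_, ⟨r, hr, rfl, hφ⟩, hlt⟩ := lt_sSup_iff.1 (hρ.trans_le (iInf_le _ p))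
  exact ⟨r, (ENNReal.lt_ofReal_iff_toReal_lt hfin).1 hlt, hφ⟩

variable [IsContMDiffRiemannianBundle (𝓡 n) ∞ (EuclideanSpace ℝ (Fin n))
  (fun x : M ↦ TangentSpace (𝓡 n) x)]

/-- The existence time involves ρ and c but neither p nor the radius of the chart; this uniformity
yields completeness. -/
lemma IsNormalChart.exists_isMIntegralCurveOn {p : M} {r ρ c : ℝ} (hφ : IsNormalChart φ p r)
    (hρ : 0 < ρ) (hρr : ρ < r) (hc : 0 < c) {A : (x : M) → TangentSpace (𝓡 n) x}
    (hA : ContMDiff (𝓡 n) (𝓡 n).tangent ∞ (fun x ↦ (⟨x, A x⟩ : TangentBundle (𝓡 n) M)))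
    (hAc : ∀ x, ‖A x‖ ≤ c) :
    ∃ γ : ℝ → M, γ 0 = p ∧ IsMIntegralCurveOn γ A (Ioo (-(ρ / (2 * c))) (ρ / (2 * c))) := by
  have hr : 0 < r := hρ.trans hρr
  have hN := hφ.isNormalMetric hr
  have h0 := (hφ.chart_eq hr).1
  obtain ⟨hm, hs, ht, -⟩ := hφ
  obtain ⟨y, hy0, hy⟩ := exists_hasDerivAt_of_inner_le hρ hρr hc
    (ht ▸ contDiffOn_chartField hm hA) fun y hy ↦ by
      have h1 := hN.abs_inner_le hy (chartField φ A y)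
      rw [chartMetric_chartField hm A (ht ▸ hy), Real.sqrt_sq (norm_nonneg _), mul_comm] at h1
      exact h1.trans (mul_le_mul_of_nonneg_right (hAc _) (norm_nonneg _))
  refine ⟨fun t ↦ φ.symm (y t), ?_, fun t h ↦ ?_⟩
  · change φ.symm (y 0) = p
    rw [hy0, ← h0, φ.left_inv (hs ▸ Metric.mem_ball_self hr)]
  · exact (hasMFDerivAt_chart_symm hm (ht ▸ (hy t h).1) (hy t h).2).hasMFDerivWithinAt

variable [IsRiemannianManifold (𝓡 n) M]

lemma IsMIntegralCurve.dist_le {A : (x : M) → TangentSpace (𝓡 n) x}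
    (hA : ContMDiff (𝓡 n) (𝓡 n).tangent ∞ (fun x ↦ (⟨x, A x⟩ : TangentBundle (𝓡 n) M)))
    {γ : ℝ → M} (hγ : IsMIntegralCurve γ A) {c : ℝ} (hc : 0 ≤ c) (hAc : ∀ x, ‖A x‖ ≤ c) {a b : ℝ}
    (hab : a ≤ b) : dist (γ a) (γ b) ≤ c * (b - a) := by
  refine dist_le_of_norm_mfderiv_le hab
    ((hγ.contMDiff_of_contMDiff hA).of_le (by simp)).contMDiffOn hc fun t _ ↦ ?_
  have h : mfderiv 𝓘(ℝ, ℝ) (𝓡 n) γ t (1 : ℝ) = (1 : ℝ) • A (γ t) :=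
    congrArg (fun L ↦ L (1 : ℝ)) (hγ t).mfderiv
  rw [h, one_smul]
  exact hAc _

/-- Along an integral curve, the distance to the initial point increases for a short time, which is
controlled by the radius of a normal chart and bounds on the curvature and the vector field. -/
theorem IsNormalChart.monotoneOn_dist {p : M} {r c₁ c₂ K T : ℝ} (hφ : IsNormalChart φ p r)
    (hc₁ : 0 ≤ c₁) (hc₂ : 0 < c₂) (hK : 0 ≤ K) (hR : CurvatureDerivBoundedBy n M 0 K)
    {A : (x : M) → TangentSpace (𝓡 n) x}
    (hA : ContMDiff (𝓡 n) (𝓡 n).tangent ∞ (fun x ↦ (⟨x, A x⟩ : TangentBundle (𝓡 n) M)))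
    (hA₁ : ∀ x, ‖A x‖ ≤ c₁) (hA₂ : CovDerivBoundedBy A c₂)
    (hT : 0 < T) (hTr : c₁ * T < r) (hTK : K * (c₁ * T) ^ 2 < 1 / 4) (hTc : c₂ * T < 1 / 32)
    {γ : ℝ → M} (hγ : IsMIntegralCurve γ A) (hγ0 : γ 0 = p) :
    MonotoneOn (fun t ↦ dist (γ 0) (γ t)) (Icc (0 : ℝ) T) ∧
      (A p ≠ 0 → StrictMonoOn (fun t ↦ dist (γ 0) (γ t)) (Icc (0 : ℝ) T)) := by
  have hr : 0 < r := (mul_nonneg hc₁ hT.le).trans_lt hTr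
  have hN := hφ.isNormalMetric hr
  have h0 := (hφ.chart_eq hr).1
  have hdist := fun q (hq : q ∈ Metric.ball p r) ↦ hφ.dist_eq hr hq
  obtain ⟨hm, hs, ht, -⟩ := hφ
  have hdle : ∀ t ∈ Icc 0 T, dist p (γ t) ≤ c₁ * T := by
    intro t h
    have h1 := hγ.dist_le hA hc₁ hA₁ h.1
    rw [hγ0, sub_zero] at h1
    exact h1.trans (mul_le_mul_of_nonneg_left h.2 hc₁)
  have hball : ∀ t ∈ Icc 0 T, γ t ∈ Metric.ball p r := fun t h ↦ by
    rw [Metric.mem_ball, dist_comm]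
    exact (hdle t h).trans_lt hTr
  have heq : ∀ t ∈ Icc 0 T, dist (γ 0) (γ t) = ‖φ (γ t)‖ := fun t h ↦ by
    rw [hγ0, hdist _ (hball t h)]
  have hA0 : A p ≠ 0 → chartField φ A 0 ≠ 0 := by
    intro h h1
    have h2 := chartLift_chartField hm A (ht ▸ Metric.mem_ball_self hr)
    rw [h1, map_zero] at h2
    have h3 : ∀ x, x = p → A x = 0 → False := by
      rintro x rfl h4
      exact h h4
    exact h3 _ (by rw [← h0, φ.left_inv (hs ▸ Metric.mem_ball_self hr)]) h2.symm
  have key := hN.radial_growth hK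
    (fun y hy ↦ hR.abs_le hm (ht ▸ hy))
    (A := chartField φ A) (T := T)
    (fun y hy ↦ ((contDiffOn_chartField hm hA).contDiffAt
      (φ.open_target.mem_nhds (ht ▸ hy))).differentiableAt (by simp)) hc₂
    (fun y hy ↦ hA₂.sqrt_le hA hm (ht ▸ hy)) (y := fun t ↦ φ (γ t))
    (fun t h ↦ hasDerivAt_chart hm (hs ▸ hball t h) (hγ t)) (by rw [hγ0, h0])
    (fun t h ↦ ht ▸ φ.map_source (hs ▸ hball t h))
    (fun t h ↦ by
      rw [← hdist _ (hball t h)]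
      refine lt_of_le_of_lt (mul_le_mul_of_nonneg_left ?_ hK) hTK
      exact pow_le_pow_left₀ dist_nonneg (hdle t h) 2) hTc.le
  exact ⟨key.1.congr fun t h ↦ (heq t h).symm,
    fun h ↦ (key.2 (hA0 h)).congr fun t h ↦ (heq t h).symm⟩

lemma CurvatureDerivBoundedBy.mono {k : ℕ} {c c' : ℝ} (h : CurvatureDerivBoundedBy n M k c)
    (hc : c ≤ c') : CurvatureDerivBoundedBy n M k c' :=
  fun φ hφ x hx ↦ (h φ hφ x hx).trans hc

end Main

end

/-! ### Completeness and a common growth time -/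

theorem mainTheorem11 {n : ℕ} {M : Type*} [MetricSpace M] [ConnectedSpace M]
    [SecondCountableTopology M] [ChartedSpace (EuclideanSpace ℝ (Fin n)) M]
    [IsManifold (𝓡 n) ∞ M] [RiemannianBundle (fun x : M ↦ TangentSpace (𝓡 n) x)]
    [IsContMDiffRiemannianBundle (𝓡 n) ∞ (EuclideanSpace ℝ (Fin n))
      (fun x : M ↦ TangentSpace (𝓡 n) x)]
    [IsRiemannianManifold (𝓡 n) M]
    (hM : IsOfBoundedGeometry n M)
    (A : (x : M) → TangentSpace (𝓡 n) x)
    (hA : ContMDiff (𝓡 n) (𝓡 n).tangent ∞ (fun x ↦ (⟨x, A x⟩ : TangentBundle (𝓡 n) M)))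
    (c₁ c₂ : ℝ) (hc₁ : 0 < c₁) (hc₂ : 0 < c₂)
    (hA₁ : ∀ x, ‖A x‖ ≤ c₁) (hA₂ : CovDerivBoundedBy A c₂) :
    (∀ γ₀ : M, ∃! γ : ℝ → M, γ 0 = γ₀ ∧ IsMIntegralCurve γ A) ∧
    (∀ γ : ℝ → M, IsMIntegralCurve γ A → ContMDiff 𝓘(ℝ, ℝ) (𝓡 n) ∞ γ) ∧
    ∃ T > 0, ∀ γ₀ : M, ∀ γ : ℝ → M, γ 0 = γ₀ → IsMIntegralCurve γ A →
      MonotoneOn (fun t ↦ dist (γ 0) (γ t)) (Icc (0 : ℝ) T) ∧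
      (A γ₀ ≠ 0 → StrictMonoOn (fun t ↦ dist (γ 0) (γ t)) (Icc (0 : ℝ) T)) := by
  obtain ⟨ρ, hρ, hchart⟩ :=
    exists_isNormalChart_of_injectivityRadius_pos hM.injectivityRadius_pos
  have hA' := hA.of_le (m := 1) (by simp)
  refine ⟨fun γ₀ ↦ ?_, fun γ hγ ↦ hγ.contMDiff_of_contMDiff hA, ?_⟩
  · obtain ⟨γ, hγ0, hγ⟩ := exists_isMIntegralCurve_of_isMIntegralCurveOn hA'
      (ε := ρ / (2 * c₁)) (by positivity) (fun p ↦ by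
        obtain ⟨r, hr, φ, hφ⟩ := hchart p
        exact hφ.exists_isMIntegralCurveOn hρ hr hc₁ hA hA₁) γ₀
    exact ⟨γ, ⟨hγ0, hγ⟩, fun γ' h ↦ isMIntegralCurve_Ioo_eq_of_contMDiff_boundaryless (t₀ := 0)
      hA' h.2 hγ (h.1.trans hγ0.symm)⟩
  · obtain ⟨K, hK⟩ := hM.curvature_bounded 0
    -- The three strict inequalities hold at T = 0, hence for small positive T. They keep γ in the
    -- chart, in the range of the Hessian comparison, and in the range of the Grönwall estimate. The
    -- maximum makes the curvature bound nonnegative.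
    obtain ⟨T, ⟨h1, h2, h3⟩, hT⟩ : ∃ T : ℝ, (c₁ * T < ρ ∧ max K 0 * (c₁ * T) ^ 2 < 1 / 4 ∧
        c₂ * T < 1 / 32) ∧ 0 < T := by
      have h1 : ∀ᶠ T in 𝓝 (0 : ℝ), c₁ * T < ρ :=
        ContinuousAt.eventually_lt (by fun_prop) continuousAt_const (by simpa)
      have h2 : ∀ᶠ T in 𝓝 (0 : ℝ), max K 0 * (c₁ * T) ^ 2 < 1 / 4 :=
        ContinuousAt.eventually_lt (by fun_prop) continuousAt_const (by simp)
      have h3 : ∀ᶠ T in 𝓝 (0 : ℝ), c₂ * T < 1 / 32 :=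
        ContinuousAt.eventually_lt (by fun_prop) continuousAt_const (by simp)
      have h4 := (h1.and (h2.and h3)).filter_mono (nhdsWithin_le_nhds (s := Ioi (0 : ℝ)))
      exact (h4.and self_mem_nhdsWithin).exists
    refine ⟨T, hT, fun γ₀ γ hγ0 hγ ↦ ?_⟩
    obtain ⟨r, hr, φ, hφ⟩ := hchart γ₀
    exact hφ.monotoneOn_dist hc₁.le hc₂ (le_max_right K 0) (hK.mono (le_max_left K 0)) hA hA₁ hA₂ hT
      (h1.trans hr) h2 h3 hγ hγ0
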